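/- **Setting.** For each $n$ let $\{P_\theta^n:\theta\in\Theta\}$ be probability laws on a sample space $\mathcal X_n$ with densities $p_\theta^n$, jointly measurable in $(\theta,x)$, with respect to a $\sigma$-finite measure $\mu=\mu_n$; $(\Theta,\|\cdot\|)$ is a Banach space with its Borel $\sigma$-algebra. Let $\Pi(\cdot\mid\lambda)$, $\lambda\in\Lambda\subset\mathbb R^k$, be priors on $\Theta$ depending measurably on $\lambda$ (they may depend on $n$), let $\Lambda_n\subset\Lambda$, and fix $\theta_0\in\Theta$ and $K>0$. Write $\ell_n(\theta)=\log p_\theta^n$, and let $\epsilon_n(\lambda)\ge 0$ and $\tilde c_0\ge1$ satisfy, for all large $n$ and all $\lambda\in\Lambda_n$, $$\tilde c_0^{-1}n\epsilon_n(\lambda)^2\le-\log\Pi(\|\theta-\theta_0\|\le K\epsilon_n(\lambda)\mid\lambda)\le\tilde c_0\,n\epsilon_n(\lambda)^2 .$$ For sequences $m_n,M_n\to\infty$ put $$\epsilon_{n,0}^2=\inf\{\epsilon_n(\lambda)^2:\lambda\in\Lambda_n,\ \epsilon_n(\lambda)^2\ge m_n(\log n)/n\}\vee m_n(\log n)/n$$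 (with $\inf\emptyset=0$ here), $\Lambda_0(a_n)=\{\lambda\in\Lambda_n:\epsilon_n(\lambda)\le a_n\epsilon_{n,0}\}$ and $\Lambda_0=\Lambda_0(M_n)$. For $\lambda,\lambda'\in\Lambda_n$ let $\psi_{\lambda,\lambda'}:\Theta\to\Theta$ be measurable maps carrying $\Pi(\cdot\mid\lambda)$ to $\Pi(\cdot\mid\lambda')$; let $\rho\ge0$ be a loss function on $\Lambda_n\times\Lambda_n$ with $\rho(\lambda,\lambda)=0$, let $0<u_n\to0$, let $q^\theta_{\lambda,n}(x)=\sup_{\lambda'\in\Lambda_n,\ \rho(\lambda,\lambda')\le u_n}p^n_{\psi_{\lambda,\lambda'}(\theta)}(x)$ (assumed jointly measurable in $(\theta,x)$), and let $Q^\theta_{\lambda,n}$ be the measure with $\mu$-density $q^\theta_{\lambda,n}$. Let $d$ be a semi-metric on $\Theta$ (symmetric, zero on the diagonal, with the triangle inequality; it may depend on $n$, and $d(\cdot,\theta_0)$ is measurable). $N(r,A,d)$ is the least number of $d$-balls of radius $r$ centred in $A$ that cover $A$; $N_n(A)$ is the same for $\rho$ and $r=u_n$. $B(\theta_0,r,2)$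 is the set of $\theta$ for which the Kullback–Leibler divergence $K(\theta_0,\theta)$ of $P^n_{\theta_0}$ from $P^n_\theta$ and the variance under $P^n_{\theta_0}$ of $\ell_n(\theta_0)-\ell_n(\theta)$ are both at most $nr^2$. Let $w_n\to\infty$ with $w_n=o(M_n)$, let $\tilde w_n=o(M_n\wedge w_n)$, and put $a_n=\max(1,\tilde w_n^2)$. **Conditions.** The bounds below hold for all large $n$, all $o(\cdot)$ and $O(\cdot)$ are uniform in $\lambda,\theta$, and the sets $\Theta_n(\lambda)\subset\Theta$ are Borel. * (A1) For $\lambda\in\Lambda_n\setminus\Lambda_0$ there are $\Theta_n(\lambda)$ such that $\log Q^\theta_{\lambda,n}(\mathcal X_n)\le o(1)\,n\epsilon_n(\lambda)^2$ for $\theta\in\Theta_n(\lambda)$ with $\|\theta-\theta_0\|\le K\epsilon_n(\lambda)$, and $\int_{\Theta_n(\lambda)^c}Q^\theta_{\lambda,n}(\mathcal X_n)\,d\Pi(\theta\mid\lambda)\le e^{-w_n^2n\epsilon_{n,0}^2}$. * (A2) For some $0<\zeta,c_1<1$ and all $\lambda\in\Lambda_n\setminus\Lambda_0$: - (tests) for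 each $\theta\in\Theta_n(\lambda)$ there is a test $\phi$ with $E^n_{\theta_0}\phi\le e^{-c_1nd(\theta,\theta_0)^2}$ and $\sup_{d(\theta,\theta')\le\zeta d(\theta,\theta_0)}Q^{\theta'}_{\lambda,n}(1-\phi)\le e^{-c_1nd(\theta,\theta_0)^2}$; - for some $c(\lambda)\ge w_n\epsilon_{n,0}/\epsilon_n(\lambda)$, every $\theta\in\Theta_n(\lambda)$ with $\|\theta-\theta_0\|>K\epsilon_n(\lambda)$ satisfies $d(\theta,\theta_0)>c(\lambda)\epsilon_n(\lambda)$; - (entropy) $\log N(\zeta u,\{u\le d(\theta,\theta_0)\le2u\}\cap\Theta_n(\lambda),d)\le c_1nu^2/2$ for all $u\ge c(\lambda)\epsilon_n(\lambda)$. * (B1) There are $\tilde\Lambda_0\subset\Lambda_0$ (depending on $n$), $M_1>0$ and $M_2\ge1$ with $\{\|\theta-\theta_0\|\le K\epsilon_n(\lambda)\}\subset B(\theta_0,M_2\epsilon_n(\lambda),2)$ for all $\lambda\in\tilde\Lambda_0$, and some $\lambda_0\in\tilde\Lambda_0$ has $\epsilon_n(\lambda_0)\le M_1\epsilon_{n,0}$.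 * (N) $\log N_n(\Lambda_n\setminus\Lambda_0)=o(nw_n^2\epsilon_{n,0}^2)$ and $\log N_n(\Lambda_0)=O(n\epsilon_{n,0}^2)$. * (C) For every $c_2>0$ there are sets $\Theta_n(\lambda)$, $\lambda\in\Lambda_0$, and constants $0<c_1,\zeta<1$ and $M',C_0>0$ such that for all $\lambda\in\Lambda_0$: - (C1) $\int_{\Theta_n(\lambda)^c}Q^\theta_{\lambda,n}(\mathcal X_n)\,d\Pi(\theta\mid\lambda)\le e^{-c_2a_nn\epsilon_{n,0}^2}$; - (C2) (tests) holds for each $\theta\in\Theta_n(\lambda)$, and (entropy) holds for all $u\ge M'M_n\epsilon_{n,0}$; - (C3) if $\theta\in\Theta_n(\lambda)$ and $d(\theta,\theta_0)\le M'M_n\epsilon_{n,0}$, then $d(\theta,\psi_{\lambda,\lambda'}(\theta))\le C_0M_n\epsilon_{n,0}$ for all $\lambda'\in\Lambda_n$ with $\rho(\lambda,\lambda')\le u_n$. * (H2) For some $c_3>0$, uniformly over $\lambda\in\tilde\Lambda_0$ and $\|\theta-\theta_0\|\le K\epsilon_n(\lambda)$, $$P^n_{\theta_0}\Big\{\inf_{\lambda'\in\Lambda_n,\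 \rho(\lambda,\lambda')\le u_n}\ell_n(\psi_{\lambda,\lambda'}(\theta))-\ell_n(\theta_0)\le-c_3n\epsilon_n(\lambda)^2\Big\}=O(e^{-n\epsilon_{n,0}^2}).$$ * (H1), with constant $\bar c_0$, for a hyper-prior $\tilde\pi$ (a probability measure on $\Lambda$, possibly depending on $n$): $\tilde\Lambda_0\subset\Lambda_0(\tilde w_n)$, $\tilde\pi(\tilde\Lambda_0)\gtrsim e^{-n\epsilon_{n,0}^2}$ and $\tilde\pi(\Lambda_n^c)\le e^{-\bar c_0a_nn\epsilon_{n,0}^2}$. **Theorem.** Assume (A1), (A2), (B1), (N), (C) and (H2). Then there is $\bar c_0>0$, not depending on the hyper-prior, such that for every hyper-prior satisfying (H1) with $\bar c_0$, the hierarchical posterior $\Pi(\cdot\mid\mathbf x_n)$, that is the posterior for the prior $\int_\Lambda\Pi(\cdot\mid\lambda)\,d\tilde\pi(\lambda)$, has the following properties. 1. There is $M>0$ with $E^n_{\theta_0}\Pi(\theta:d(\theta,\theta_0)\ge MM_n\epsilon_{n,0}\mid\mathbf x_n)=o(1)$. 2. Let $e$ be a semi-metric on $\Theta$ with $e(\cdot,\theta_0)$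 measurable (for example $e=d$), and let $\delta_n\to0$. Suppose that, with the sets $\Theta_n(\lambda)$ of (C) for each $c_2>0$, $\log Q^\theta_{\lambda,n}(\mathcal X_n)\le o(1)\,n\epsilon_n(\lambda)^2$ uniformly over $\lambda\in\Lambda_0$ and $\theta\in\Theta_n(\lambda)$ with $\|\theta-\theta_0\|\le\epsilon_n(\lambda)$, and $$\sup_{\lambda\in\Lambda_0}\frac{a_nn\epsilon_{n,0}^2}{-\log\Pi(\theta:e(\theta,\theta_0)\le2\delta_n\epsilon_{n,0}\mid\lambda)}=o(1).$$ Then $E^n_{\theta_0}\Pi(\theta:e(\theta,\theta_0)\le\delta_n\epsilon_{n,0}\mid\mathbf x_n)=o(1)$. -/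

import Mathlib

open MeasureTheory ProbabilityTheory Filter Topology Asymptotics
open scoped ENNReal NNReal

/-- A semi-metric: a metric except that distinct points may be at distance zero. -/
structure IsSemimetric {T : Type*} (d : T → T → ℝ) : Prop where
  self : ∀ x, d x x = 0
  symm : ∀ x y, d x y = d y x
  triangle : ∀ x y z, d x z ≤ d x y + d y z

/-- The covering number of `A` by balls `{a | d c a ≤ r}` with centres `c` in `A`
(it is `⊤` if there is no finite cover). -/
noncomputable def coverNum {T : Type*} (d : T → T → ℝ) (r : ℝ) (A : Set T) : ℕ∞ :=
  ⨅ (C : Finset T) (_ : (C : Set T) ⊆ A ∧ ∀ a ∈ A, ∃ c ∈ C, d c a ≤ r), (C.card : ℕ∞)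

/-- A sequence of dominated experiments with common parameter space `Θ`, and (possibly
`n`-dependent) priors on `Θ` indexed by a hyper-parameter in `L`. -/
structure BayesModel (X : ℕ → Type*) [∀ n, MeasurableSpace (X n)]
    (Θ : Type*) [MeasurableSpace Θ] (L : Type*) [MeasurableSpace L] where
  /-- the dominating measures -/
  μ : ∀ n, Measure (X n)
  sigmaFinite : ∀ n, SigmaFinite (μ n)
  /-- the densities -/
  dens : ∀ n, Θ → X n → ℝ≥0
  measurable_dens : ∀ n, Measurable (fun z : Θ × X n => dens n z.1 z.2)
  lintegral_dens : ∀ n θ, ∫⁻ x, (dens n θ x : ℝ≥0∞) ∂(μ n) = 1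
  /-- the conditional priors given the hyper-parameter -/
  prior : ℕ → Kernel L Θ
  markov : ∀ n, IsMarkovKernel (prior n)

namespace BayesModel

variable {X : ℕ → Type*} [∀ n, MeasurableSpace (X n)] {Θ : Type*} [MeasurableSpace Θ]
  {L : Type*} [MeasurableSpace L] (B : BayesModel X Θ L)

/-- The law of the `n`-th observation under the parameter `θ`. -/
noncomputable def law (n : ℕ) (θ : Θ) : Measure (X n) :=
  (B.μ n).withDensity fun x => (B.dens n θ x : ℝ≥0∞)

/-- The Kullback-Leibler divergence of the law at `θ` from the law at `θ₀`. -/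
noncomputable def KL (n : ℕ) (θ₀ θ : Θ) : ℝ≥0∞ :=
  InformationTheory.klDiv (B.law n θ₀) (B.law n θ)

/-- The centred second moment of the log-likelihood ratio (used only where `KL` is finite, so that
both densities are positive almost surely under `θ₀`). -/
noncomputable def V2 (n : ℕ) (θ₀ θ : Θ) : ℝ≥0∞ :=
  ∫⁻ x, ENNReal.ofReal
    ((Real.log (B.dens n θ₀ x) - Real.log (B.dens n θ x) - (B.KL n θ₀ θ).toReal) ^ 2)
    ∂(B.law n θ₀)

/-- The Kullback-Leibler neighbourhood of `θ₀` of radius `r`. -/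
def KLBall (n : ℕ) (θ₀ : Θ) (r : ℝ) : Set Θ :=
  {θ | B.KL n θ₀ θ ≤ ENNReal.ofReal (n * r ^ 2) ∧ B.V2 n θ₀ θ ≤ ENNReal.ofReal (n * r ^ 2)}

/-- The unnormalised hierarchical posterior mass of `A` under the hyper-prior `π`. -/
noncomputable def mass (n : ℕ) (π : Measure L) (x : X n) (A : Set Θ) : ℝ≥0∞ :=
  ∫⁻ l, ∫⁻ θ in A, (B.dens n θ x : ℝ≥0∞) ∂(B.prior n l) ∂π

/-- The hierarchical posterior mass of `A`, that is the posterior for the prior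
`∫ Π(· | λ) dπ(λ)`. -/
noncomputable def hierPosterior (n : ℕ) (π : Measure L) (x : X n) (A : Set Θ) : ℝ≥0∞ :=
  B.mass n π x A / B.mass n π x Set.univ

end BayesModel

/-- The objects used in the analysis at a true parameter `θ₀`. -/
structure Setup {X : ℕ → Type*} [∀ n, MeasurableSpace (X n)]
    {Θ : Type*} [NormedAddCommGroup Θ] [MeasurableSpace Θ]
    {L : Type*} [MeasurableSpace L] (B : BayesModel X Θ L) where
  /-- the true parameter -/
  θ₀ : Θ
  /-- the constant in the definition of the rates -/
  K : ℝ
  K_pos : 0 < K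
  /-- the sets `Λ_n` of hyper-parameters -/
  Ln : ℕ → Set L
  /-- the rates `ε_n(λ)` -/
  rate : ℕ → L → ℝ
  rate_nonneg : ∀ n l, 0 ≤ rate n l
  /-- the constant `c̃₀` (equal to one if the rates are defined by an equality) -/
  c₀ : ℝ
  one_le_c₀ : 1 ≤ c₀
  /-- `c̃₀⁻¹ n ε_n(λ)² ≤ - log Π(‖θ - θ₀‖ ≤ K ε_n(λ) | λ) ≤ c̃₀ n ε_n(λ)²` -/
  rate_spec : ∀ᶠ n in atTop, ∀ l ∈ Ln n,
    Real.exp (-(c₀ * (n * rate n l ^ 2))) ≤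
        (B.prior n l).real {θ | ‖θ - θ₀‖ ≤ K * rate n l} ∧
      (B.prior n l).real {θ | ‖θ - θ₀‖ ≤ K * rate n l} ≤
        Real.exp (-(c₀⁻¹ * (n * rate n l ^ 2)))
  /-- the sequence `m_n` in the definition of the oracle rate -/
  m : ℕ → ℝ
  m_tendsto : Tendsto m atTop atTop
  /-- the sequence `M_n` -/
  M : ℕ → ℝ
  M_tendsto : Tendsto M atTop atTop
  /-- the loss function on `Λ_n` -/
  ρ : ℕ → L → L → ℝ
  ρ_nonneg : ∀ n, ∀ l ∈ Ln n, ∀ l' ∈ Ln n, 0 ≤ ρ n l l'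
  ρ_self : ∀ n, ∀ l ∈ Ln n, ρ n l l = 0
  /-- the mesh `u_n` -/
  u : ℕ → ℝ
  u_pos : ∀ n, 0 < u n
  u_tendsto : Tendsto u atTop (𝓝 0)
  /-- the transformations `ψ_{λ,λ'}`, which carry `Π(· | λ)` to `Π(· | λ')` -/
  ψ : ℕ → L → L → Θ → Θ
  ψ_preserving : ∀ n, ∀ l ∈ Ln n, ∀ l' ∈ Ln n,
    MeasurePreserving (ψ n l l') (B.prior n l) (B.prior n l')
  measurable_sup : ∀ n, ∀ l ∈ Ln n, Measurable (fun z : Θ × X n =>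
    ⨆ l' ∈ {l' ∈ Ln n | ρ n l l' ≤ u n}, (B.dens n (ψ n l l' z.1) z.2 : ℝ≥0∞))
  /-- the semi-metric in which contraction and testing are measured -/
  d : ℕ → Θ → Θ → ℝ
  d_semimetric : ∀ n, IsSemimetric (d n)
  measurable_d : ∀ n, Measurable (fun θ => d n θ θ₀)

namespace Setup

variable {X : ℕ → Type*} [∀ n, MeasurableSpace (X n)]
  {Θ : Type*} [NormedAddCommGroup Θ] [MeasurableSpace Θ]
  {L : Type*} [MeasurableSpace L] {B : BayesModel X Θ L} (S : Setup B)

/-- The oracle rate `ε_{n,0}`; an infimum over the empty set counts as `0`, so that the rate is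
then the square root of `m_n (log n) / n`. -/
noncomputable def rate0 (n : ℕ) : ℝ :=
  Real.sqrt (max
    (sInf {e : ℝ | ∃ l ∈ S.Ln n, e = S.rate n l ^ 2 ∧ S.m n * Real.log n / n ≤ e})
    (S.m n * Real.log n / n))

/-- The quantity `n ε_{n,0}²`. -/
noncomputable def info (n : ℕ) : ℝ := n * S.rate0 n ^ 2

/-- The set `Λ₀(a_n)`, for a sequence `a_n`. -/
def oracleSet (a : ℕ → ℝ) (n : ℕ) : Set L :=
  {l ∈ S.Ln n | S.rate n l ≤ a n * S.rate0 n}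

/-- The set `Λ₀ = Λ₀(M_n)`. -/
def L0 (n : ℕ) : Set L := S.oracleSet S.M n

/-- The perturbed likelihood `q_{λ,n}^θ(x)`: the supremum of the densities at `ψ_{λ,λ'}(θ)` over all
`λ'` in `Λ_n` with `ρ(λ,λ') ≤ u_n`. -/
noncomputable def q (n : ℕ) (l : L) (θ : Θ) (x : X n) : ℝ≥0∞ :=
  ⨆ l' ∈ {l' ∈ S.Ln n | S.ρ n l l' ≤ S.u n}, (B.dens n (S.ψ n l l' θ) x : ℝ≥0∞)

/-- The total mass of the measure with density `q_{λ,n}^θ`. -/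
noncomputable def Q (n : ℕ) (l : L) (θ : Θ) : ℝ≥0∞ := ∫⁻ x, S.q n l θ x ∂(B.μ n)

/-- Existence, for each `θ` in `T`, of a test of `θ₀` against the perturbed likelihoods near `θ`,
with both errors at most `exp (-c₁ n d(θ, θ₀)²)`. -/
def HasTests (n : ℕ) (l : L) (T : Set Θ) (c₁ ζ : ℝ) : Prop :=
  ∀ θ ∈ T, ∃ φ : X n → ℝ≥0∞, Measurable φ ∧ (∀ x, φ x ≤ 1) ∧
    ∫⁻ x, φ x ∂(B.law n S.θ₀) ≤ ENNReal.ofReal (Real.exp (-(c₁ * n * S.d n θ S.θ₀ ^ 2))) ∧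
    ∀ θ', S.d n θ θ' ≤ ζ * S.d n θ S.θ₀ →
      ∫⁻ x, S.q n l θ' x * (1 - φ x) ∂(B.μ n) ≤
        ENNReal.ofReal (Real.exp (-(c₁ * n * S.d n θ S.θ₀ ^ 2)))

/-- The entropy bound for the shells `{u ≤ d(θ, θ₀) ≤ 2u} ∩ T`, for all `u ≥ r`. -/
def HasEntropy (n : ℕ) (T : Set Θ) (c₁ ζ r : ℝ) : Prop :=
  ∀ u : ℝ, r ≤ u →
    ((coverNum (S.d n) (ζ * u) ({θ | u ≤ S.d n θ S.θ₀ ∧ S.d n θ S.θ₀ ≤ 2 * u} ∩ T) : ℕ∞) : ℝ≥0∞) ≤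
      ENNReal.ofReal (Real.exp (c₁ * n * u ^ 2 / 2))

/-- Off the oracle set: the perturbed likelihoods have log-mass `o(n ε_n(λ)²)`, uniformly, on the
ball around `θ₀` within the sieve `T n λ`, and the complement of the sieve is negligible. -/
def CondA1 (T : ℕ → L → Set Θ) (w : ℕ → ℝ) : Prop :=
  (∃ η : ℕ → ℝ, Tendsto η atTop (𝓝 0) ∧ ∀ᶠ n in atTop, ∀ l ∈ S.Ln n \ S.L0 n,
    ∀ θ ∈ {θ | ‖θ - S.θ₀‖ ≤ S.K * S.rate n l} ∩ T n l,
      S.Q n l θ ≤ ENNReal.ofReal (Real.exp (η n * (n * S.rate n l ^ 2)))) ∧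
  ∀ᶠ n in atTop, ∀ l ∈ S.Ln n \ S.L0 n,
    ∫⁻ θ in (T n l)ᶜ, S.Q n l θ ∂(B.prior n l) ≤
      ENNReal.ofReal (Real.exp (-(w n ^ 2 * S.info n)))

/-- Off the oracle set: tests, comparison of the norm with `d`, and entropy. -/
def CondA2 (T : ℕ → L → Set Θ) (w : ℕ → ℝ) : Prop :=
  ∃ ζ c₁ : ℝ, 0 < ζ ∧ ζ < 1 ∧ 0 < c₁ ∧ c₁ < 1 ∧
    ∀ᶠ n in atTop, ∀ l ∈ S.Ln n \ S.L0 n,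
      S.HasTests n l (T n l) c₁ ζ ∧
      ∃ c : ℝ, w n * S.rate0 n / S.rate n l ≤ c ∧
        (T n l ∩ {θ | S.K * S.rate n l < ‖θ - S.θ₀‖} ⊆
          T n l ∩ {θ | c * S.rate n l < S.d n θ S.θ₀}) ∧
        S.HasEntropy n (T n l) c₁ ζ (c * S.rate n l)

/-- The sets `Lt n` (`Λ̃₀`) lie in the oracle sets, norm balls are contained in Kullback-Leibler
neighbourhoods over them, and they hold a hyper-parameter whose rate is of the oracle order. -/
def CondB1 (Lt : ℕ → Set L) : Prop :=
  ∃ M₁ M₂ : ℝ, 0 < M₁ ∧ 1 ≤ M₂ ∧ ∀ᶠ n in atTop, Lt n ⊆ S.L0 n ∧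
    (∀ l ∈ Lt n, {θ | ‖θ - S.θ₀‖ ≤ S.K * S.rate n l} ⊆
      B.KLBall n S.θ₀ (M₂ * S.rate n l)) ∧
    ∃ l ∈ Lt n, S.rate n l ≤ M₁ * S.rate0 n

/-- On the oracle set: for every exponent `c₂` the complements of the sieves `T c₂ n λ` have
perturbed mass at most `exp (-c₂ a_n n ε_{n,0}²)`, and tests, entropy and the stability of `d` under
the transformations `ψ_{λ,λ'}` hold on the sieves. -/
def CondC (T : ℝ → ℕ → L → Set Θ) (a : ℕ → ℝ) : Prop :=
  ∀ c₂ : ℝ, 0 < c₂ →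
    (∀ᶠ n in atTop, ∀ l ∈ S.L0 n,
      ∫⁻ θ in (T c₂ n l)ᶜ, S.Q n l θ ∂(B.prior n l) ≤
        ENNReal.ofReal (Real.exp (-(c₂ * a n * S.info n)))) ∧
    ∃ c₁ ζ R C₀ : ℝ, 0 < c₁ ∧ c₁ < 1 ∧ 0 < ζ ∧ ζ < 1 ∧ 0 < R ∧ 0 < C₀ ∧
      ∀ᶠ n in atTop, ∀ l ∈ S.L0 n,
        S.HasTests n l (T c₂ n l) c₁ ζ ∧
        S.HasEntropy n (T c₂ n l) c₁ ζ (R * S.M n * S.rate0 n) ∧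
        ∀ θ ∈ {θ | S.d n S.θ₀ θ ≤ R * S.M n * S.rate0 n} ∩ T c₂ n l,
          ∀ l' ∈ S.Ln n, S.ρ n l l' ≤ S.u n →
            S.d n θ (S.ψ n l l' θ) ≤ C₀ * S.M n * S.rate0 n

/-- `log N_n(Λ_n \ Λ₀) = o(n w_n² ε_{n,0}²)`. -/
def CoverOutside (w : ℕ → ℝ) : Prop :=
  ∃ η : ℕ → ℝ, Tendsto η atTop (𝓝 0) ∧ ∀ᶠ n in atTop,
    ((coverNum (S.ρ n) (S.u n) (S.Ln n \ S.L0 n) : ℕ∞) : ℝ≥0∞) ≤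
      ENNReal.ofReal (Real.exp (η n * (w n ^ 2 * S.info n)))

/-- `log N_n(Λ₀) = O(n ε_{n,0}²)`. -/
def CoverInside : Prop :=
  ∃ C : ℝ, ∀ᶠ n in atTop,
    ((coverNum (S.ρ n) (S.u n) (S.L0 n) : ℕ∞) : ℝ≥0∞) ≤
      ENNReal.ofReal (Real.exp (C * S.info n))

/-- The hyper-priors `π` put mass of order at least `exp (-n ε_{n,0}²)` on `Lt n ⊆ Λ₀(w̃_n)`, and at
most `exp (-c a_n n ε_{n,0}²)` outside `Λ_n`. -/
def CondH1 (Lt : ℕ → Set L) (wt a : ℕ → ℝ) (c : ℝ) (π : ℕ → Measure L) : Prop :=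
  (∀ᶠ n in atTop, Lt n ⊆ S.oracleSet wt n) ∧
  (∃ b : ℝ, 0 < b ∧ ∀ᶠ n in atTop,
    ENNReal.ofReal (b * Real.exp (-(S.info n))) ≤ π n (Lt n)) ∧
  ∀ᶠ n in atTop, π n (S.Ln n)ᶜ ≤ ENNReal.ofReal (Real.exp (-(c * a n * S.info n)))

/-- Deviations of the perturbed log-likelihoods over `Lt n`. The event `inf ℓ_n(ψ_{λ,λ'}(θ)) - ℓ_n(θ₀) ≤ -c₃ n ε_n(λ)²` is written through
the densities themselves, so that vanishing densities are treated correctly. -/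
def CondH2 (Lt : ℕ → Set L) : Prop :=
  ∃ c₃ C : ℝ, 0 < c₃ ∧ ∀ᶠ n in atTop, ∀ l ∈ Lt n, ∀ θ : Θ, ‖θ - S.θ₀‖ ≤ S.K * S.rate n l →
    B.law n S.θ₀ {x |
      ⨅ l' ∈ {l' ∈ S.Ln n | S.ρ n l l' ≤ S.u n}, (B.dens n (S.ψ n l l' θ) x : ℝ≥0∞) ≤
        ENNReal.ofReal (Real.exp (-(c₃ * (n * S.rate n l ^ 2)))) * B.dens n S.θ₀ x} ≤
      ENNReal.ofReal (C * Real.exp (-(S.info n)))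

/-- The condition for the lower bound: control of the perturbed likelihoods over `Λ₀`, and
`a_n n ε_{n,0}² / (- log Π(e(θ, θ₀) ≤ 2 δ_n ε_{n,0} | λ))` tends to zero uniformly over `Λ₀`. -/
def CondLower (T : ℝ → ℕ → L → Set Θ) (a : ℕ → ℝ) (e : ℕ → Θ → Θ → ℝ) (δ : ℕ → ℝ) : Prop :=
  (∀ c₂ : ℝ, 0 < c₂ → ∃ η : ℕ → ℝ, Tendsto η atTop (𝓝 0) ∧ ∀ᶠ n in atTop, ∀ l ∈ S.L0 n,
    ∀ θ ∈ {θ | ‖θ - S.θ₀‖ ≤ S.rate n l} ∩ T c₂ n l,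
      S.Q n l θ ≤ ENNReal.ofReal (Real.exp (η n * (n * S.rate n l ^ 2)))) ∧
  ∀ A : ℝ, 0 < A → ∀ᶠ n in atTop, ∀ l ∈ S.L0 n,
    B.prior n l {θ | e n θ S.θ₀ ≤ 2 * δ n * S.rate0 n} ≤
      ENNReal.ofReal (Real.exp (-(A * a n * S.info n)))

end Setup

/-! Write I for `info`, that is nε₀². The proof compares exponents. Off an event of probability
O(exp(-I)), the evidence is at least exp(-cD a I) times the density at θ₀ (`measure_evidence_lt_le`,
`exists_law_evidenceFails_le`). A part of the posterior is therefore negligible once some test φ has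
small error under θ₀ and the numerator, weighted by 1 - φ, has integral well below exp(-cD a I)
(`lintegral_min_one_div_le`).

Outside Λ_n the hyper-prior itself is small enough. Inside, the hyper-parameters are discretised by
a net: ψ carries the prior at a net point c to the prior at any nearby λ, so the numerator is
bounded by a finite sum over the net, at the price of replacing densities by q
(`mass_restrict_le_sum_q`). One global test per net point then suffices (`exists_global_test`,
`partialRisk_le_of_cover`).

Off Λ₀ all of Θ becomes negligible at scale w²I, which dominates a I: the sieve complement is small
by (A1), the norm ball has tiny prior mass because nε(λ)² > M²I, and the rest of the sieve is d-far
from θ₀ and is tested. On Λ₀ the same scheme works at radius of order Mε₀, with (C3) passing from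
net points to their neighbours. For the second claim the part over Λ₀ is bounded by the prior mass
of the e-ball alone, through Fubini. -/

theorem IsSemimetric.nonneg {T : Type*} {d : T → T → ℝ} (hd : IsSemimetric d) (x y : T) :
    0 ≤ d x y := by
  have h := hd.triangle x y x
  rw [hd.self, hd.symm y x] at h
  linarith

/-- An infimum in `ℕ∞` is attained, and the finite bound excludes attainment at an inadmissible
finset, whose inner infimum is `⊤`. -/
theorem exists_finset_of_coverNum_le {T : Type*} {d : T → T → ℝ} {r : ℝ} {A : Set T} {b : ℝ}
    (h : ((coverNum d r A : ℕ∞) : ℝ≥0∞) ≤ ENNReal.ofReal b) :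
    ∃ C : Finset T, (C : Set T) ⊆ A ∧ (∀ a ∈ A, ∃ c ∈ C, d c a ≤ r) ∧
      (C.card : ℝ≥0∞) ≤ ENNReal.ofReal b := by
  obtain ⟨C, hC⟩ := ENat.exists_eq_iInf
    (fun C : Finset T => ⨅ (_ : (C : Set T) ⊆ A ∧ ∀ a ∈ A, ∃ c ∈ C, d c a ≤ r), (C.card : ℕ∞))
  by_cases hP : (C : Set T) ⊆ A ∧ ∀ a ∈ A, ∃ c ∈ C, d c a ≤ r
  · refine ⟨C, hP.1, hP.2, ?_⟩
    have h1 : coverNum d r A = (C.card : ℕ∞) := by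
      rw [coverNum, ← hC, iInf_pos hP]
    simpa [h1] using h
  · have h1 : coverNum d r A = ⊤ := by
      rw [coverNum, ← hC, iInf_neg hP]
    simp [h1] at h

/-! ### Truncated ratios, tests and exponent bookkeeping -/

/-- `φ` may exceed one, where `1 - φ` is truncated to zero; tests can thus be summed over nets and
shells without being capped. -/
theorem ENNReal.min_one_le_add_one_sub_mul (φ y : ℝ≥0∞) : min 1 y ≤ φ + (1 - φ) * y := by
  rcases le_total 1 φ with h | h
  · exact (min_le_left _ _).trans (h.trans le_self_add)
  · calc min 1 y = (φ + (1 - φ)) * min 1 y := by rw [add_tsub_cancel_of_le h, one_mul]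
      _ = φ * min 1 y + (1 - φ) * min 1 y := add_mul _ _ _
      _ ≤ φ * 1 + (1 - φ) * y := by gcongr <;> simp
      _ = _ := by rw [mul_one]

theorem ENNReal.min_one_add_le (a b : ℝ≥0∞) : min 1 (a + b) ≤ min 1 a + min 1 b := by
  rcases le_total 1 a with h | h
  · rw [min_eq_left h]
    exact (min_le_left _ _).trans le_self_add
  · rcases le_total 1 b with h' | h'
    · rw [min_eq_left h']
      exact (min_le_left _ _).trans le_add_self
    · rw [min_eq_right h, min_eq_right h']
      exact min_le_right _ _

/-- Bound for the expectation of a truncated ratio `N / D` under the law with density `p₀`: off the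
event where `κ * D` falls below `p₀`, a test `φ` may be used against the numerator. -/
theorem lintegral_min_one_div_le {X : Type*} [MeasurableSpace X] (μ : Measure X)
    {p₀ D N φ : X → ℝ≥0∞} (hp₀ : Measurable p₀) (hD : Measurable D) (hN : Measurable N)
    (hφ : Measurable φ) (κ : ℝ≥0∞) :
    ∫⁻ x, min 1 (N x / D x) ∂(μ.withDensity p₀) ≤
      (μ.withDensity p₀) {x | κ * D x < p₀ x} + ∫⁻ x, φ x ∂(μ.withDensity p₀) +
        κ * ∫⁻ x, N x * (1 - φ x) ∂μ := by
  set E := {x | κ * D x < p₀ x} with hE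
  have hEm : MeasurableSet E := measurableSet_lt (hD.const_mul κ) hp₀
  have h1 : ∀ x, min 1 (N x / D x) ≤ E.indicator 1 x + φ x +
      Eᶜ.indicator (fun x => (1 - φ x) * (N x / D x)) x := by
    intro x
    by_cases hx : x ∈ E
    · simp only [Set.indicator_of_mem hx, Pi.one_apply]
      exact (min_le_left _ _).trans (by rw [add_assoc]; exact le_self_add)
    · have hx' : x ∈ Eᶜ := hx
      simp only [Set.indicator_of_notMem hx, Set.indicator_of_mem hx', zero_add]
      exact ENNReal.min_one_le_add_one_sub_mul _ _
  have hind : Measurable (E.indicator (1 : X → ℝ≥0∞)) := measurable_one.indicator hEm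
  have hm3 : Measurable (Eᶜ.indicator (fun x => (1 - φ x) * (N x / D x))) :=
    ((measurable_const.sub hφ).mul (hN.div hD)).indicator hEm.compl
  refine (lintegral_mono h1).trans ?_
  rw [lintegral_add_right _ hm3, lintegral_add_right _ hφ, lintegral_indicator_one hEm]
  gcongr
  have hNφ : Measurable fun x => N x * (1 - φ x) := hN.mul (measurable_const.sub hφ)
  rw [lintegral_withDensity_eq_lintegral_mul _ hp₀ hm3, ← lintegral_const_mul κ hNφ]
  refine lintegral_mono fun x => ?_
  simp only [Pi.mul_apply]
  by_cases hx : x ∈ E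
  · have : x ∉ Eᶜ := fun h => h hx
    simp [Set.indicator_of_notMem this]
  · have hx' : x ∈ Eᶜ := hx
    rw [Set.indicator_of_mem hx']
    have hle : p₀ x ≤ κ * D x := not_lt.mp hx
    calc p₀ x * ((1 - φ x) * (N x / D x)) ≤ (κ * D x) * ((1 - φ x) * (N x / D x)) := by gcongr
      _ = κ * (D x * (N x / D x) * (1 - φ x)) := by ring
      _ ≤ κ * (N x * (1 - φ x)) := by
        gcongr
        exact ENNReal.mul_div_le

/-- Measurability is asked of `f` and not of `s`, since the sets of hyper-parameters are arbitrary.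
-/
theorem setLIntegral_le_mul_of_forall_le {α : Type*} [MeasurableSpace α] {μ : Measure α}
    {s : Set α} {f : α → ℝ≥0∞} (hf : Measurable f) {c : ℝ≥0∞} (h : ∀ a ∈ s, f a ≤ c) :
    ∫⁻ a in s, f a ∂μ ≤ c * μ s := by
  calc ∫⁻ a in s, f a ∂μ ≤ ∫⁻ _ in s, c ∂μ := by
        refine lintegral_mono_ae ?_
        rw [ae_restrict_iff (measurableSet_le hf measurable_const)]
        exact Eventually.of_forall h
    _ = c * μ s := setLIntegral_const _ _

theorem setLIntegral_le_of_forall_le {α : Type*} [MeasurableSpace α] {μ : Measure α}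
    [IsProbabilityMeasure μ] {s : Set α} (hs : MeasurableSet s) {f : α → ℝ≥0∞} {c : ℝ≥0∞}
    (h : ∀ a ∈ s, f a ≤ c) : ∫⁻ a in s, f a ∂μ ≤ c * μ s :=
  (setLIntegral_mono' hs h).trans (setLIntegral_const _ _).le

/-- The budget over a net: `s` is the exponent of its size, `r` that of the inverse evidence, `p`
and `g` those of the two errors at a net point. The factor 2 comes from the dyadic series of tests,
and 3 allows for at most three pieces of the parameter space. -/
theorem card_mul_add_scale_mul_le {N κ α β : ℝ≥0∞} {r s p g t : ℝ}
    (hN : N ≤ ENNReal.ofReal (Real.exp s)) (hκ : κ = ENNReal.ofReal (Real.exp r))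
    (hα : α ≤ ENNReal.ofReal (2 * Real.exp p)) (hβ : β ≤ ENNReal.ofReal (3 * Real.exp g))
    (h1 : s + p ≤ t) (h2 : r + s + g ≤ t) :
    N * α + κ * (N * β) ≤ ENNReal.ofReal (5 * Real.exp t) := by
  calc N * α + κ * (N * β)
      ≤ ENNReal.ofReal (Real.exp s) * ENNReal.ofReal (2 * Real.exp p) +
        ENNReal.ofReal (Real.exp r) *
          (ENNReal.ofReal (Real.exp s) * ENNReal.ofReal (3 * Real.exp g)) := by
        rw [hκ]; gcongr
    _ = ENNReal.ofReal (2 * Real.exp (s + p) + 3 * Real.exp (r + s + g)) := by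
        rw [ENNReal.ofReal_add (by positivity) (by positivity),
          ← ENNReal.ofReal_mul (by positivity), ← ENNReal.ofReal_mul (by positivity),
          ← ENNReal.ofReal_mul (by positivity), Real.exp_add, Real.exp_add, Real.exp_add]
        congr 2 <;> ring
    _ ≤ ENNReal.ofReal (5 * Real.exp t) := by
        refine ENNReal.ofReal_le_ofReal ?_
        have := Real.exp_le_exp.mpr h1
        have := Real.exp_le_exp.mpr h2
        linarith

/-! ### Lower bound for the evidence -/

/-- Lower bound in probability for the evidence of a mixture prior, when for every `l` in a set `Lt`
of mixing parameters a ball of prior mass at least `β` consists of parameters at which the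
likelihood ratio exceeds `t` with probability at least `1 - γ`. -/
theorem measure_evidence_lt_le {X Θ L : Type*} [MeasurableSpace X] [MeasurableSpace Θ]
    [MeasurableSpace L] (π : Measure L) [IsProbabilityMeasure π] (J : Kernel L Θ)
    [IsMarkovKernel J] {p : Θ → X → ℝ≥0∞} (hp : Measurable fun z : Θ × X => p z.1 z.2)
    {p₀ : X → ℝ≥0∞} (hp₀ : Measurable p₀) (P₀ : Measure X) [IsProbabilityMeasure P₀]
    (Lt : Set L) (t β γ : ℝ≥0∞) (hβ : β ≠ 0) (ψ : L → Θ → Θ) (U : L → Set Θ)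
    (hψ : ∀ l ∈ Lt, MeasurePreserving (ψ l) (J l) (J l))
    (hU : ∀ l ∈ Lt, MeasurableSet (U l)) (hβU : ∀ l ∈ Lt, β ≤ J l (U l))
    (hγ : ∀ l ∈ Lt, ∀ θ ∈ U l, P₀ {x | p (ψ l θ) x ≤ t * p₀ x} ≤ γ) :
    P₀ {x | ∫⁻ l, ∫⁻ θ, p θ x ∂(J l) ∂π < t * β * π Lt / 4 * p₀ x} ≤ 4 * γ := by
  -- `ψ l` is not assumed measurable in `l`, so `G` is defined without it and is jointly measurable;
  -- `ψ l` enters only at fixed `l`, through the invariance of `J l`.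
  set G : L → X → ℝ≥0∞ := fun l x => J l {θ | t * p₀ x < p θ x} with hG
  have hGm : Measurable fun z : L × X => G z.1 z.2 := by
    have hS : MeasurableSet {y : (L × X) × Θ | t * p₀ y.1.2 < p y.2 y.1.2} :=
      measurableSet_lt ((hp₀.comp (measurable_snd.comp measurable_fst)).const_mul t)
        (hp.comp (measurable_snd.prodMk (measurable_snd.comp measurable_fst)))
    exact Kernel.measurable_kernel_prodMk_left (κ := J.comap Prod.fst measurable_fst) hS
  have hBm : MeasurableSet {z : L × X | G z.1 z.2 < β / 2} :=
    measurableSet_lt hGm measurable_const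
  set g : L → ℝ≥0∞ := fun l => P₀ {x | G l x < β / 2} with hg
  have hgm : Measurable g := measurable_measure_prodMk_left hBm
  have hgLt : ∀ l ∈ Lt, g l ≤ 2 * γ := by
    intro l hl
    set b := J l (U l) with hb
    have hb0 : b ≠ 0 := fun h => hβ (le_antisymm (h ▸ hβU l hl) zero_le)
    have hbT : b ≠ ∞ := measure_ne_top _ _
    have hpψ : Measurable fun z : X × Θ => p (ψ l z.2) z.1 :=
      hp.comp (((hψ l hl).measurable.comp measurable_snd).prodMk measurable_fst)
    have hV : MeasurableSet {z : X × Θ | z.2 ∈ U l ∧ p (ψ l z.2) z.1 ≤ t * p₀ z.1} :=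
      (measurable_snd (hU l hl)).inter
        (measurableSet_le hpψ ((hp₀.comp measurable_fst).const_mul t))
    set bad : X → ℝ≥0∞ := fun x => J l {θ | θ ∈ U l ∧ p (ψ l θ) x ≤ t * p₀ x} with hbad
    have hbadm : Measurable bad := measurable_measure_prodMk_left hV
    -- The ball is covered by its bad points and the `ψ l`-preimage of the good parameters, whose
    -- mass is `G l x`. If the latter is below half of `b`, at least half of the ball is bad, and
    -- Markov's inequality applies.
    have hsub : {x | G l x < β / 2} ⊆ {x | b / 2 ≤ bad x} := by
      intro x hx
      by_contra hcon
      have hcon : bad x < b / 2 := not_le.mp hcon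
      have hx : G l x < b / 2 := lt_of_lt_of_le hx (by gcongr; exact hβU l hl)
      have h1 : b ≤ bad x + G l x := by
        have h2 : G l x = J l (ψ l ⁻¹' {θ | t * p₀ x < p θ x}) :=
          ((hψ l hl).measure_preimage (measurableSet_lt measurable_const
            (hp.comp (measurable_id.prodMk measurable_const))).nullMeasurableSet).symm
        rw [h2]
        refine (measure_mono ?_).trans (measure_union_le _ _)
        intro θ hθ
        rcases le_or_gt (p (ψ l θ) x) (t * p₀ x) with h | h
        · exact Or.inl ⟨hθ, h⟩
        · exact Or.inr h
      have h3 : bad x + G l x < b / 2 + b / 2 := ENNReal.add_lt_add hcon hx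
      rw [ENNReal.add_halves] at h3
      exact absurd h1 (not_le.mpr h3)
    have hint : ∫⁻ x, bad x ∂P₀ ≤ γ * b := by
      calc ∫⁻ x, bad x ∂P₀
          = (P₀.prod (J l)) {z : X × Θ | z.2 ∈ U l ∧ p (ψ l z.2) z.1 ≤ t * p₀ z.1} :=
            (Measure.prod_apply hV).symm
        _ = ∫⁻ θ, P₀ {x | θ ∈ U l ∧ p (ψ l θ) x ≤ t * p₀ x} ∂(J l) :=
            Measure.prod_apply_symm hV
        _ ≤ ∫⁻ θ, (U l).indicator (fun _ => γ) θ ∂(J l) := by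
            refine lintegral_mono fun θ => ?_
            by_cases hθ : θ ∈ U l
            · rw [Set.indicator_of_mem hθ]
              refine (measure_mono ?_).trans (hγ l hl θ hθ)
              exact fun x hx => hx.2
            · simp [hθ]
        _ = γ * b := by rw [lintegral_indicator_const (hU l hl)]
    have hmk : b / 2 * g l ≤ γ * b :=
      calc b / 2 * g l ≤ b / 2 * P₀ {x | b / 2 ≤ bad x} :=
          mul_le_mul_right (measure_mono hsub) _
        _ ≤ ∫⁻ x, bad x ∂P₀ := mul_meas_ge_le_lintegral hbadm _
        _ ≤ γ * b := hint
    have h4 : b * g l ≤ b * (2 * γ) := by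
      calc b * g l = 2 * (b / 2 * g l) := by
            rw [← mul_assoc, ENNReal.mul_div_cancel two_ne_zero ENNReal.ofNat_ne_top]
        _ ≤ 2 * (γ * b) := by gcongr
        _ = b * (2 * γ) := by ring
    exact (ENNReal.mul_le_mul_iff_right hb0 hbT).mp h4
  -- `Lt` need not be measurable. `L'` is measurable, contains `Lt` and satisfies the same bound, so
  -- the second Fubini and Markov argument runs over `L'`; monotonicity then returns to `Lt`.
  set L' : Set L := {l | g l ≤ 2 * γ} with hL'
  have hL'm : MeasurableSet L' := measurableSet_le hgm measurable_const
  have hLtL' : Lt ⊆ L' := hgLt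
  by_cases hπ : π L' = 0
  · have : π Lt = 0 := measure_mono_null hLtL' hπ
    simp [this]
  have hVm : MeasurableSet {z : X × L | z.2 ∈ L' ∧ G z.2 z.1 < β / 2} :=
    (measurable_snd hL'm).inter (measurable_swap hBm)
  set h : X → ℝ≥0∞ := fun x => π {l | l ∈ L' ∧ G l x < β / 2} with hh
  have hhm : Measurable h := measurable_measure_prodMk_left hVm
  have hint : ∫⁻ x, h x ∂P₀ ≤ 2 * γ * π L' := by
    calc ∫⁻ x, h x ∂P₀ = (P₀.prod π) {z : X × L | z.2 ∈ L' ∧ G z.2 z.1 < β / 2} :=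
          (Measure.prod_apply hVm).symm
      _ = ∫⁻ l, P₀ {x | l ∈ L' ∧ G l x < β / 2} ∂π := Measure.prod_apply_symm hVm
      _ ≤ ∫⁻ l, L'.indicator (fun _ => 2 * γ) l ∂π := by
          refine lintegral_mono fun l => ?_
          by_cases hl : l ∈ L'
          · rw [Set.indicator_of_mem hl]
            exact (measure_mono fun x hx => hx.2).trans hl
          · simp [hl]
      _ = 2 * γ * π L' := by rw [lintegral_indicator_const hL'm]
  have hsub : {x | ∫⁻ l, ∫⁻ θ, p θ x ∂(J l) ∂π < t * β * π Lt / 4 * p₀ x} ⊆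
      {x | π L' / 2 ≤ h x} := by
    intro x hx
    by_contra hcon
    have hcon : h x < π L' / 2 := not_le.mp hcon
    have hgood : π L' / 2 ≤ π {l | β / 2 ≤ G l x} := by
      by_contra hc
      have h1 : π L' ≤ h x + π {l | β / 2 ≤ G l x} := by
        refine (measure_mono ?_).trans (measure_union_le _ _)
        intro l hl
        rcases le_or_gt (β / 2) (G l x) with h | h
        · exact Or.inr h
        · exact Or.inl ⟨hl, h⟩
      have h3 := ENNReal.add_lt_add hcon (not_le.mp hc)
      rw [ENNReal.add_halves] at h3
      exact absurd h1 (not_le.mpr h3)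
    have hpx : Measurable fun θ => p θ x := hp.comp (measurable_id.prodMk measurable_const)
    have hin : ∀ l, t * p₀ x * G l x ≤ ∫⁻ θ, p θ x ∂(J l) := by
      intro l
      have hle : G l x ≤ J l {θ | t * p₀ x ≤ p θ x} :=
        measure_mono fun θ (hθ : t * p₀ x < p θ x) => hθ.le
      exact (mul_le_mul_right hle _).trans (mul_meas_ge_le_lintegral hpx _)
    have hlow : t * p₀ x * (β / 2) * (π L' / 2) ≤ ∫⁻ l, ∫⁻ θ, p θ x ∂(J l) ∂π := by
      calc t * p₀ x * (β / 2) * (π L' / 2)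
          ≤ t * p₀ x * (β / 2) * π {l | t * p₀ x * (β / 2) ≤ ∫⁻ θ, p θ x ∂(J l)} := by
            gcongr
            refine hgood.trans (measure_mono fun l hl => ?_)
            exact le_trans (by gcongr; exact hl) (hin l)
        _ ≤ _ := mul_meas_ge_le_lintegral hpx.lintegral_kernel _
    have heq : t * p₀ x * (β / 2) * (π L' / 2) = t * β * π L' / 4 * p₀ x := by
      have h4 : (2 : ℝ≥0∞)⁻¹ * 2⁻¹ = 4⁻¹ := by
        rw [← ENNReal.mul_inv (by simp) (by simp)]; norm_num
      simp only [div_eq_mul_inv]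
      rw [← h4]; ring
    rw [heq] at hlow
    have hle : t * β * π Lt / 4 * p₀ x ≤ t * β * π L' / 4 * p₀ x := by gcongr
    exact absurd (hle.trans hlow) (not_le.mpr hx)
  have hmk : π L' / 2 * P₀ {x | π L' / 2 ≤ h x} ≤ 2 * γ * π L' :=
    (mul_meas_ge_le_lintegral hhm _).trans hint
  have h4 : π L' * P₀ {x | π L' / 2 ≤ h x} ≤ π L' * (4 * γ) := by
    calc π L' * P₀ {x | π L' / 2 ≤ h x} = 2 * (π L' / 2 * P₀ {x | π L' / 2 ≤ h x}) := by
          rw [← mul_assoc, ENNReal.mul_div_cancel two_ne_zero ENNReal.ofNat_ne_top]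
      _ ≤ 2 * (2 * γ * π L') := by gcongr
      _ = π L' * (4 * γ) := by ring
  exact (measure_mono hsub).trans
    ((ENNReal.mul_le_mul_iff_right hπ (measure_ne_top _ _)).mp h4)

/-! ### Contributions of sets of hyper-parameters to the posterior -/

namespace BayesModel

variable {X : ℕ → Type*} [∀ n, MeasurableSpace (X n)] {Θ : Type*} [MeasurableSpace Θ]
  {L : Type*} [MeasurableSpace L] (B : BayesModel X Θ L)

instance instSigmaFinite (n : ℕ) : SigmaFinite (B.μ n) := B.sigmaFinite n

instance instIsMarkovKernel (n : ℕ) : IsMarkovKernel (B.prior n) := B.markov n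

instance instIsProbabilityMeasureLaw (n : ℕ) (θ : Θ) : IsProbabilityMeasure (B.law n θ) :=
  ⟨by rw [law, withDensity_apply _ MeasurableSet.univ, Measure.restrict_univ]
      exact B.lintegral_dens n θ⟩

theorem measurable_dens_coe (n : ℕ) :
    Measurable fun z : Θ × X n => (B.dens n z.1 z.2 : ℝ≥0∞) :=
  (B.measurable_dens n).coe_nnreal_ennreal

theorem measurable_dens_param (n : ℕ) (x : X n) :
    Measurable fun θ : Θ => (B.dens n θ x : ℝ≥0∞) :=
  (B.measurable_dens_coe n).comp (measurable_id.prodMk measurable_const)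

theorem measurable_dens_obs (n : ℕ) (θ : Θ) :
    Measurable fun x : X n => (B.dens n θ x : ℝ≥0∞) :=
  (B.measurable_dens_coe n).comp (measurable_const.prodMk measurable_id)

theorem measurable_setLIntegral_dens (n : ℕ) {A : Set Θ} (hA : MeasurableSet A) :
    Measurable fun z : L × X n => ∫⁻ θ in A, (B.dens n θ z.2 : ℝ≥0∞) ∂(B.prior n z.1) := by
  have h : Measurable fun y : (L × X n) × Θ => (B.dens n y.2 y.1.2 : ℝ≥0∞) :=
    (B.measurable_dens_coe n).comp
      (measurable_snd.prodMk (measurable_snd.comp measurable_fst))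
  exact Measurable.setLIntegral_kernel_prod_right
    (κ := (B.prior n).comap (Prod.fst : L × X n → L) measurable_fst)
    (f := fun (z : L × X n) θ => (B.dens n θ z.2 : ℝ≥0∞)) h hA

theorem measurable_mass (n : ℕ) (π : Measure L) [SFinite π] {A : Set Θ} (hA : MeasurableSet A) :
    Measurable fun x : X n => B.mass n π x A :=
  (B.measurable_setLIntegral_dens n hA).lintegral_prod_left'

theorem mass_mono (n : ℕ) (π : Measure L) (x : X n) {A A' : Set Θ} (h : A ⊆ A') :
    B.mass n π x A ≤ B.mass n π x A' :=
  lintegral_mono fun _ => lintegral_mono_set h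

theorem mass_restrict_union_le (n : ℕ) (π : Measure L) (x : X n) (A : Set Θ) (s t : Set L) :
    B.mass n (π.restrict (s ∪ t)) x A ≤
      B.mass n (π.restrict s) x A + B.mass n (π.restrict t) x A := by
  refine (lintegral_mono' (Measure.restrict_union_le s t) le_rfl).trans ?_
  rw [lintegral_add_measure]
  rfl

/-- By Fubini the observation is integrated first; every density integrates to one, which leaves the
prior mass of `A`. -/
theorem lintegral_mass_restrict_le (n : ℕ) (π : Measure L) [IsFiniteMeasure π] {A : Set Θ}
    (hA : MeasurableSet A) (s : Set L) {c : ℝ≥0∞} (hc : ∀ l ∈ s, B.prior n l A ≤ c) :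
    ∫⁻ x, B.mass n (π.restrict s) x A ∂(B.μ n) ≤ c * π s := by
  calc ∫⁻ x, B.mass n (π.restrict s) x A ∂(B.μ n)
      = ∫⁻ l in s, ∫⁻ x, ∫⁻ θ in A, (B.dens n θ x : ℝ≥0∞) ∂(B.prior n l) ∂(B.μ n) ∂π :=
        lintegral_lintegral_swap
          ((B.measurable_setLIntegral_dens n hA).comp measurable_swap).aemeasurable
    _ = ∫⁻ l in s, B.prior n l A ∂π := by
        refine lintegral_congr fun l => ?_
        rw [lintegral_lintegral_swap (f := fun x θ => (B.dens n θ x : ℝ≥0∞))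
          ((B.measurable_dens_coe n).comp measurable_swap).aemeasurable]
        simp [B.lintegral_dens n]
    _ ≤ c * π s := setLIntegral_le_mul_of_forall_le ((B.prior n).measurable_coe hA) hc

/-- The expectation under `θ₀` of the truncated contribution to the posterior mass of `A` of the
hyper-parameters in `s`. -/
noncomputable def partialRisk (n : ℕ) (θ₀ : Θ) (π : Measure L) (s : Set L) (A : Set Θ) : ℝ≥0∞ :=
  ∫⁻ x, min 1 (B.mass n (π.restrict s) x A / B.mass n π x Set.univ) ∂(B.law n θ₀)

/-- The event that `κ` times the evidence falls below the density at `θ₀`. -/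
def evidenceFails (n : ℕ) (θ₀ : Θ) (π : Measure L) (κ : ℝ≥0∞) : Set (X n) :=
  {x | κ * B.mass n π x Set.univ < B.dens n θ₀ x}

theorem measurable_partialRisk_integrand (n : ℕ) (π : Measure L) [IsFiniteMeasure π] (s : Set L)
    {A : Set Θ} (hA : MeasurableSet A) :
    Measurable fun x : X n =>
      min 1 (B.mass n (π.restrict s) x A / B.mass n π x Set.univ) :=
  measurable_const.min
    ((B.measurable_mass n _ hA).div (B.measurable_mass n π MeasurableSet.univ))

/-- The posterior is at most one and `min 1` is subadditive, so each range is truncated separately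
and can be given its own test. -/
theorem lintegral_hierPosterior_le (n : ℕ) (θ₀ : Θ) (π : Measure L) [IsFiniteMeasure π]
    {A : Set Θ} (hA : MeasurableSet A) (s t v : Set L) (hstv : s ∪ t ∪ v = Set.univ) :
    ∫⁻ x, B.hierPosterior n π x A ∂(B.law n θ₀) ≤
      B.partialRisk n θ₀ π s A + B.partialRisk n θ₀ π t A + B.partialRisk n θ₀ π v A := by
  unfold partialRisk
  rw [← lintegral_add_left (B.measurable_partialRisk_integrand n π s hA),
    ← lintegral_add_right _ (B.measurable_partialRisk_integrand n π v hA)]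
  refine lintegral_mono fun x => ?_
  have h1 : B.hierPosterior n π x A ≤ 1 :=
    ENNReal.div_le_of_le_mul (by rw [one_mul]; exact B.mass_mono n π x (Set.subset_univ _))
  have h2 : B.mass n π x A ≤ B.mass n (π.restrict s) x A + B.mass n (π.restrict t) x A +
      B.mass n (π.restrict v) x A := by
    calc B.mass n π x A = B.mass n (π.restrict (s ∪ t ∪ v)) x A := by
          rw [hstv, Measure.restrict_univ]
      _ ≤ _ := (B.mass_restrict_union_le n π x A _ _).trans
          (by gcongr; exact B.mass_restrict_union_le n π x A _ _)
  have h3 : B.hierPosterior n π x A ≤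
      min 1 ((B.mass n (π.restrict s) x A + B.mass n (π.restrict t) x A +
        B.mass n (π.restrict v) x A) / B.mass n π x Set.univ) :=
    le_min h1 (ENNReal.div_le_div_right h2 _)
  refine h3.trans ?_
  rw [ENNReal.add_div, ENNReal.add_div]
  exact (ENNReal.min_one_add_le _ _).trans (by gcongr; exact ENNReal.min_one_add_le _ _)

theorem partialRisk_le_of_test (n : ℕ) (θ₀ : Θ) (π : Measure L) [IsFiniteMeasure π] (s : Set L)
    {A : Set Θ} (hA : MeasurableSet A) (κ : ℝ≥0∞) {φ : X n → ℝ≥0∞} (hφ : Measurable φ) :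
    B.partialRisk n θ₀ π s A ≤
      B.law n θ₀ (B.evidenceFails n θ₀ π κ) + ∫⁻ x, φ x ∂(B.law n θ₀) +
        κ * ∫⁻ x, B.mass n (π.restrict s) x A * (1 - φ x) ∂(B.μ n) :=
  lintegral_min_one_div_le (B.μ n) (B.measurable_dens_obs n θ₀)
    (B.measurable_mass n π MeasurableSet.univ) (B.measurable_mass n _ hA) hφ κ

theorem partialRisk_le_of_prior_le (n : ℕ) (θ₀ : Θ) (π : Measure L) [IsFiniteMeasure π]
    (s : Set L) {A : Set Θ} (hA : MeasurableSet A) (κ : ℝ≥0∞) {c : ℝ≥0∞}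
    (hc : ∀ l ∈ s, B.prior n l A ≤ c) :
    B.partialRisk n θ₀ π s A ≤
      B.law n θ₀ (B.evidenceFails n θ₀ π κ) + κ * (c * π s) := by
  refine (B.partialRisk_le_of_test n θ₀ π s hA κ (φ := fun _ => 0) measurable_const).trans ?_
  simp only [lintegral_zero, add_zero, tsub_zero, mul_one]
  gcongr
  exact B.lintegral_mass_restrict_le n π hA s hc

end BayesModel

/-! ### Global tests and discretisation of the hyper-parameter -/

namespace Setup

variable {X : ℕ → Type*} [∀ n, MeasurableSpace (X n)]
  {Θ : Type*} [NormedAddCommGroup Θ] [MeasurableSpace Θ]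
  {L : Type*} [MeasurableSpace L] {B : BayesModel X Θ L} (S : Setup B)

theorem measurable_q {n : ℕ} {l : L} (hl : l ∈ S.Ln n) :
    Measurable fun z : Θ × X n => S.q n l z.1 z.2 :=
  S.measurable_sup n l hl

/-- Tests against all points of the sieve at distance at least `u` from the truth, obtained by
combining the local tests over covers of the dyadic shells. -/
theorem exists_global_test {n : ℕ} {l : L} {T : Set Θ} {c₁ ζ u : ℝ} (hζ : 0 < ζ) (hu : 0 < u)
    (hc₁ : 0 < c₁) (hbig : Real.log 2 ≤ c₁ * n * u ^ 2 / 2)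
    (htest : S.HasTests n l T c₁ ζ) (hent : S.HasEntropy n T c₁ ζ u) :
    ∃ φ : X n → ℝ≥0∞, Measurable φ ∧
      ∫⁻ x, φ x ∂(B.law n S.θ₀) ≤ ENNReal.ofReal (2 * Real.exp (-(c₁ * n * u ^ 2 / 2))) ∧
      ∀ θ ∈ T, u ≤ S.d n θ S.θ₀ →
        ∫⁻ x, S.q n l θ x * (1 - φ x) ∂(B.μ n) ≤
          ENNReal.ofReal (Real.exp (-(c₁ * n * u ^ 2))) := by
  choose! φ hφm _ hφ1 hφ2 using htest
  have hu2 : ∀ j : ℕ, u ≤ 2 ^ j * u := fun j =>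
    le_mul_of_one_le_left hu.le (one_le_pow₀ one_le_two)
  choose C hCsub hCcov hCcard using fun j : ℕ => exists_finset_of_coverNum_le (hent _ (hu2 j))
  have hmono : ∀ v : ℝ, u ≤ v → Real.exp (-(c₁ * n * v ^ 2)) ≤ Real.exp (-(c₁ * n * u ^ 2)) := by
    intro v hv
    gcongr
  refine ⟨fun x => ∑' j, ∑ c ∈ C j, φ c x, ?_, ?_, ?_⟩
  · exact Measurable.tsum fun j => Finset.measurable_fun_sum _ fun c hc => hφm c (hCsub j hc).2
  · set y := Real.exp (-(c₁ * n * u ^ 2 / 2)) with hy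
    have hy0 : 0 < y := Real.exp_pos _
    have hy2 : y ≤ 1 / 2 := by
      rw [hy, one_div, ← Real.exp_log (show (0 : ℝ) < 2⁻¹ by norm_num), Real.log_inv]
      exact Real.exp_le_exp.mpr (neg_le_neg hbig)
    -- At radius `v = 2 ^ j * u` the entropy consumes half of the testing exponent. Since `4 ^ j ≥ 1
    -- + j`, the other half gives `y ^ (1 + j)`, and `y ≤ 1 / 2` makes the series geometric.
    have hj : ∀ j : ℕ, ∫⁻ x, ∑ c ∈ C j, φ c x ∂(B.law n S.θ₀) ≤ ENNReal.ofReal (y * 2⁻¹ ^ j) := by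
      intro j
      set v := 2 ^ j * u with hv
      have hv0 : 0 < v := by positivity
      rw [lintegral_finsetSum' _ fun c hc => (hφm c (hCsub j hc).2).aemeasurable]
      calc ∑ c ∈ C j, ∫⁻ x, φ c x ∂(B.law n S.θ₀)
          ≤ ∑ c ∈ C j, ENNReal.ofReal (Real.exp (-(c₁ * n * v ^ 2))) := by
            refine Finset.sum_le_sum fun c hc => (hφ1 c (hCsub j hc).2).trans ?_
            have := (hCsub j hc).1.1
            gcongr
        _ = (C j).card * ENNReal.ofReal (Real.exp (-(c₁ * n * v ^ 2))) := by
            rw [Finset.sum_const, nsmul_eq_mul]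
        _ ≤ ENNReal.ofReal (Real.exp (c₁ * n * v ^ 2 / 2)) *
              ENNReal.ofReal (Real.exp (-(c₁ * n * v ^ 2))) := by
            gcongr
            exact hCcard j
        _ = ENNReal.ofReal (Real.exp (-(c₁ * n * v ^ 2 / 2))) := by
            rw [← ENNReal.ofReal_mul (Real.exp_pos _).le, ← Real.exp_add]
            congr 2
            ring
        _ ≤ ENNReal.ofReal (y * 2⁻¹ ^ j) := by
            refine ENNReal.ofReal_le_ofReal ?_
            have hexp : Real.exp (-(c₁ * n * v ^ 2 / 2)) ≤ y * y ^ j := by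
              rw [hy, ← Real.exp_nat_mul, ← Real.exp_add]
              refine Real.exp_le_exp.mpr ?_
              have h4 : (1 : ℝ) + j ≤ (2 ^ j) ^ 2 := by
                have h5 : (1 : ℝ) + j ≤ 2 ^ j := by
                  have := one_add_mul_le_pow (show (-2 : ℝ) ≤ 1 by norm_num) j
                  norm_num at this
                  linarith
                have h6 : (1 : ℝ) ≤ 2 ^ j := one_le_pow₀ one_le_two
                nlinarith
              have h7 : 0 ≤ c₁ * n * u ^ 2 / 2 := by positivity
              have h8 := mul_le_mul_of_nonneg_right h4 h7
              rw [hv]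
              nlinarith
            refine hexp.trans ?_
            gcongr
            linarith
    rw [lintegral_tsum fun j =>
      (Finset.measurable_fun_sum _ fun c hc => hφm c (hCsub j hc).2).aemeasurable]
    calc ∑' j, ∫⁻ x, ∑ c ∈ C j, φ c x ∂(B.law n S.θ₀)
        ≤ ∑' j : ℕ, ENNReal.ofReal (y * 2⁻¹ ^ j) := ENNReal.tsum_le_tsum hj
      _ = ENNReal.ofReal (∑' j : ℕ, y * 2⁻¹ ^ j) := by
          rw [ENNReal.ofReal_tsum_of_nonneg (fun j => by positivity)]
          exact (summable_geometric_of_lt_one (by norm_num) (by norm_num)).mul_left y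
      _ = ENNReal.ofReal (2 * y) := by
          rw [tsum_mul_left, tsum_geometric_inv_two, mul_comm]
  · intro θ hθ hd
    obtain ⟨j, hj1, hj2⟩ := exists_nat_pow_near ((one_le_div hu).mpr hd) one_lt_two
    rw [le_div_iff₀ hu] at hj1
    rw [div_lt_iff₀ hu] at hj2
    have hmem : θ ∈ {θ | 2 ^ j * u ≤ S.d n θ S.θ₀ ∧ S.d n θ S.θ₀ ≤ 2 * (2 ^ j * u)} ∩ T := by
      refine ⟨⟨hj1, ?_⟩, hθ⟩
      rw [pow_succ] at hj2
      linarith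
    obtain ⟨c, hc, hdc⟩ := hCcov j θ hmem
    have hcd := (hCsub j hc).1.1
    -- The centre `c` lies in the shell itself, so the covering radius `ζ * (2 ^ j * u)` is at most
    -- `ζ` times its distance to θ₀.
    have h1 := hφ2 c (hCsub j hc).2 θ (hdc.trans (by gcongr))
    refine le_trans (lintegral_mono fun x => ?_)
      (h1.trans (ENNReal.ofReal_le_ofReal (hmono _ ((hu2 j).trans hcd))))
    gcongr
    exact (Finset.single_le_sum (f := fun c => φ c x) (fun _ _ => zero_le) hc).trans
      (ENNReal.le_tsum j)

/-- The mass contributed by a set of hyper-parameters is bounded by perturbed likelihoods at the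
points of a net. -/
theorem mass_restrict_le_sum_q {n : ℕ} (π : Measure L) [IsProbabilityMeasure π] {s : Set L}
    (hs : s ⊆ S.Ln n) {C : Finset L} (hCs : (C : Set L) ⊆ s)
    (hcov : ∀ l ∈ s, ∃ c ∈ C, S.ρ n c l ≤ S.u n) {A : Set Θ} (hA : MeasurableSet A)
    {V : L → Set Θ} (hstab : ∀ c ∈ C, ∀ l ∈ s, S.ρ n c l ≤ S.u n → ∀ θ, S.ψ n c l θ ∈ A → θ ∈ V c)
    (x : X n) :
    B.mass n (π.restrict s) x A ≤ ∑ c ∈ C, ∫⁻ θ in V c, S.q n c θ x ∂(B.prior n c) := by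
  have hm : Measurable fun l => ∫⁻ θ in A, (B.dens n θ x : ℝ≥0∞) ∂(B.prior n l) :=
    (B.measurable_setLIntegral_dens n hA).comp (measurable_id.prodMk measurable_const)
  refine (setLIntegral_le_mul_of_forall_le hm (c := ∑ c ∈ C, ∫⁻ θ in V c, S.q n c θ x
    ∂(B.prior n c)) fun l hl => ?_).trans (mul_le_of_le_one_right zero_le prob_le_one)
  obtain ⟨c, hc, hcl⟩ := hcov l hl
  refine le_trans ?_ (Finset.single_le_sum
    (f := fun c => ∫⁻ θ in V c, S.q n c θ x ∂(B.prior n c)) (fun _ _ => zero_le) hc)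
  have hψ := S.ψ_preserving n c (hs (hCs hc)) l (hs hl)
  rw [← hψ.setLIntegral_comp_preimage hA (B.measurable_dens_param n x)]
  calc ∫⁻ θ in S.ψ n c l ⁻¹' A, (B.dens n (S.ψ n c l θ) x : ℝ≥0∞) ∂(B.prior n c)
      ≤ ∫⁻ θ in V c, (B.dens n (S.ψ n c l θ) x : ℝ≥0∞) ∂(B.prior n c) :=
        lintegral_mono_set fun θ hθ => hstab c hc l hl hcl θ hθ
    _ ≤ ∫⁻ θ in V c, S.q n c θ x ∂(B.prior n c) := by
        refine lintegral_mono fun θ => ?_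
        exact le_iSup₂_of_le (f := fun l' (_ : l' ∈ {l' ∈ S.Ln n | S.ρ n c l' ≤ S.u n}) =>
          (B.dens n (S.ψ n c l' θ) x : ℝ≥0∞)) l ⟨hs hl, hcl⟩ le_rfl

/-- The test is the sum of the tests at the net points: the errors under θ₀ add up, while in the
term of `c` the factor `1 - ∑ φ` is at most `1 - φ c`. -/
theorem partialRisk_le_of_cover {n : ℕ} (π : Measure L) [IsProbabilityMeasure π] {s : Set L}
    (hs : s ⊆ S.Ln n) {C : Finset L} (hCs : (C : Set L) ⊆ s)
    (hcov : ∀ l ∈ s, ∃ c ∈ C, S.ρ n c l ≤ S.u n) {A : Set Θ} (hA : MeasurableSet A)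
    {V : L → Set Θ} (hstab : ∀ c ∈ C, ∀ l ∈ s, S.ρ n c l ≤ S.u n → ∀ θ, S.ψ n c l θ ∈ A → θ ∈ V c)
    (κ : ℝ≥0∞) {α β : ℝ≥0∞}
    (htest : ∀ c ∈ C, ∃ φ : X n → ℝ≥0∞, Measurable φ ∧ ∫⁻ x, φ x ∂(B.law n S.θ₀) ≤ α ∧
      ∫⁻ θ in V c, ∫⁻ x, S.q n c θ x * (1 - φ x) ∂(B.μ n) ∂(B.prior n c) ≤ β) :
    B.partialRisk n S.θ₀ π s A ≤
      B.law n S.θ₀ (B.evidenceFails n S.θ₀ π κ) + C.card * α + κ * (C.card * β) := by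
  choose! φ hφm hφα hφβ using htest
  have hsum : Measurable fun x => ∑ c ∈ C, φ c x :=
    Finset.measurable_fun_sum _ fun c hc => hφm c hc
  refine (B.partialRisk_le_of_test n S.θ₀ π s hA κ hsum).trans ?_
  gcongr
  · rw [lintegral_finsetSum' _ fun c hc => (hφm c hc).aemeasurable]
    exact (Finset.sum_le_card_nsmul _ _ _ hφα).trans (by rw [nsmul_eq_mul])
  · have hqm : ∀ c ∈ C, Measurable fun z : X n × Θ => S.q n c z.2 z.1 * (1 - φ c z.1) :=
      fun c hc => ((S.measurable_q (hs (hCs hc))).comp measurable_swap).mul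
        (measurable_const.sub ((hφm c hc).comp measurable_fst))
    calc ∫⁻ x, B.mass n (π.restrict s) x A * (1 - ∑ c ∈ C, φ c x) ∂(B.μ n)
        ≤ ∫⁻ x, ∑ c ∈ C, ∫⁻ θ in V c, S.q n c θ x * (1 - φ c x) ∂(B.prior n c) ∂(B.μ n) := by
          refine lintegral_mono fun x => ?_
          refine (mul_le_mul_left
            (S.mass_restrict_le_sum_q π hs hCs hcov hA hstab x) _).trans ?_
          rw [Finset.sum_mul]
          refine Finset.sum_le_sum fun c hc => ?_
          have hqx : Measurable fun θ => S.q n c θ x :=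
            (S.measurable_q (hs (hCs hc))).comp (measurable_id.prodMk measurable_const)
          rw [lintegral_mul_const _ hqx]
          gcongr
          exact Finset.single_le_sum (f := fun c => φ c x) (fun _ _ => zero_le) hc
      _ = ∑ c ∈ C, ∫⁻ θ in V c, ∫⁻ x, S.q n c θ x * (1 - φ c x) ∂(B.μ n) ∂(B.prior n c) := by
          rw [lintegral_finsetSum' _ fun c hc =>
            ((hqm c hc).lintegral_prod_right' (ν := (B.prior n c).restrict (V c))).aemeasurable]
          exact Finset.sum_congr rfl fun c hc =>
            lintegral_lintegral_swap (hqm c hc).aemeasurable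
      _ ≤ C.card * β := (Finset.sum_le_card_nsmul _ _ _ hφβ).trans (by rw [nsmul_eq_mul])

end Setup

/-! ### Rates, evidence, and the three ranges of hyper-parameters -/

namespace Setup

variable {X : ℕ → Type*} [∀ n, MeasurableSpace (X n)]
  {Θ : Type*} [NormedAddCommGroup Θ] [MeasurableSpace Θ]
  {L : Type*} [MeasurableSpace L] {B : BayesModel X Θ L} (S : Setup B)

theorem rate0_nonneg (n : ℕ) : 0 ≤ S.rate0 n := Real.sqrt_nonneg _

theorem rate0_sq (n : ℕ) : S.rate0 n ^ 2 = max
    (sInf {e : ℝ | ∃ l ∈ S.Ln n, e = S.rate n l ^ 2 ∧ S.m n * Real.log n / n ≤ e})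
    (S.m n * Real.log n / n) := by
  -- `S.m n` may be negative for small `n`; nonnegativity comes from the infimum, taken over squares
  -- and zero on the empty set.
  refine Real.sq_sqrt (le_max_of_le_left (Real.sInf_nonneg ?_))
  rintro e ⟨l, -, rfl, -⟩
  positivity

theorem tendsto_info : Tendsto S.info atTop atTop := by
  refine tendsto_atTop_mono' _ ?_
    (S.m_tendsto.atTop_mul_atTop₀ (Real.tendsto_log_atTop.comp tendsto_natCast_atTop_atTop))
  filter_upwards [eventually_gt_atTop 0] with n hn
  have hn' : (0 : ℝ) < n := Nat.cast_pos.mpr hn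
  calc S.m n * Real.log n = n * (S.m n * Real.log n / n) := by field_simp
    _ ≤ S.info n := by
      rw [info, rate0_sq]
      gcongr
      exact le_max_right _ _

theorem rate0_pos_of_info_pos {n : ℕ} (h : 0 < S.info n) : 0 < S.rate0 n := by
  refine lt_of_le_of_ne (S.rate0_nonneg n) fun h0 => ?_
  rw [info, ← h0] at h
  simp at h

theorem measurableSet_normBall [BorelSpace Θ] (r : ℝ) :
    MeasurableSet {θ : Θ | ‖θ - S.θ₀‖ ≤ r} :=
  (isClosed_le (by fun_prop) continuous_const).measurableSet

theorem oracleSet_subset (a : ℕ → ℝ) (n : ℕ) : S.oracleSet a n ⊆ S.Ln n := fun _ h => h.1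

/-- The factor `exp (c a_n n ε_{n,0}²)` compensating the decay of the evidence. -/
noncomputable def evidenceScale (a : ℕ → ℝ) (c : ℝ) (n : ℕ) : ℝ≥0∞ :=
  ENNReal.ofReal (Real.exp (c * (a n * S.info n)))

/-- The constants are fixed before the hyper-prior; its constant `b` only affects how large `n` must
be. -/
theorem exists_law_evidenceFails_le [BorelSpace Θ] {Lt : ℕ → Set L} {wt a : ℕ → ℝ}
    (ha : ∀ n, a n = max 1 (wt n ^ 2)) (hH2 : S.CondH2 Lt) :
    ∃ cD C : ℝ, 0 < cD ∧ ∀ π : ℕ → Measure L, (∀ n, IsProbabilityMeasure (π n)) →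
      (∀ᶠ n in atTop, Lt n ⊆ S.oracleSet wt n) →
      (∃ b : ℝ, 0 < b ∧ ∀ᶠ n in atTop,
        ENNReal.ofReal (b * Real.exp (-(S.info n))) ≤ π n (Lt n)) →
      ∀ᶠ n in atTop, B.law n S.θ₀
          (B.evidenceFails n S.θ₀ (π n) (S.evidenceScale a cD n)) ≤
        ENNReal.ofReal (C * Real.exp (-(S.info n))) := by
  obtain ⟨c₃, C, hc₃, hH2⟩ := hH2
  have hc₀ : 0 < S.c₀ := zero_lt_one.trans_le S.one_le_c₀
  -- `c₃` pays for the likelihood ratio and `S.c₀` for the prior mass of the ball; of the remaining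
  -- 2, one unit pays for the hyper-prior mass of `Lt n` and one for the factor `b / 4`.
  refine ⟨c₃ + S.c₀ + 2, 4 * C, by positivity, fun π hπ hsub ⟨b, hb, hbπ⟩ => ?_⟩
  filter_upwards [hH2, hsub, hbπ, S.rate_spec, S.tendsto_info.eventually_ge_atTop 0,
    S.tendsto_info.eventually_ge_atTop (Real.log (4 / b))] with n hH2 hsub hbπ hspec hinfo hinfob
  set y := a n * S.info n with hy
  have ha1 : 1 ≤ a n := by rw [ha]; exact le_max_left _ _
  have hinfoy : S.info n ≤ y := le_mul_of_one_le_left hinfo ha1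
  have hLn : Lt n ⊆ S.Ln n := hsub.trans (S.oracleSet_subset _ n)
  have hrate : ∀ l ∈ Lt n, n * S.rate n l ^ 2 ≤ y := by
    intro l hl
    calc n * S.rate n l ^ 2 ≤ n * (wt n * S.rate0 n) ^ 2 := by
          have := S.rate_nonneg n l
          gcongr
          exact (hsub hl).2
      _ = wt n ^ 2 * S.info n := by rw [info]; ring
      _ ≤ y := by
          rw [hy]
          gcongr
          rw [ha]; exact le_max_right _ _
  have key := measure_evidence_lt_le (π n) (B.prior n)
    (p := fun θ x => (B.dens n θ x : ℝ≥0∞)) (B.measurable_dens_coe n)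
    (B.measurable_dens_obs n S.θ₀) (B.law n S.θ₀) (Lt n)
    (ENNReal.ofReal (Real.exp (-(c₃ * y)))) (ENNReal.ofReal (Real.exp (-(S.c₀ * y))))
    (ENNReal.ofReal (C * Real.exp (-(S.info n)))) (by simp [Real.exp_pos])
    (fun l => S.ψ n l l) (fun l => {θ | ‖θ - S.θ₀‖ ≤ S.K * S.rate n l})
    (fun l hl => S.ψ_preserving n l (hLn hl) l (hLn hl))
    (fun l _ => S.measurableSet_normBall _)
    (fun l hl => by
      refine (ENNReal.ofReal_le_ofReal (?_ : _ ≤ (B.prior n l).real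
        {θ | ‖θ - S.θ₀‖ ≤ S.K * S.rate n l})).trans (by simp)
      refine le_trans ?_ (hspec l (hLn hl)).1
      gcongr
      exact hrate l hl)
    (fun l hl θ hθ => by
      refine le_trans (measure_mono fun x hx => ?_) (hH2 l hl θ hθ)
      have hx : (B.dens n (S.ψ n l l θ) x : ℝ≥0∞) ≤
        ENNReal.ofReal (Real.exp (-(c₃ * y))) * B.dens n S.θ₀ x := hx
      -- The infimum in (H2) is at most its term at λ' = λ. The map ψ_{λ,λ} need not be the
      -- identity; it is enough that it preserves the prior.
      have hmem : l ∈ {l' ∈ S.Ln n | S.ρ n l l' ≤ S.u n} :=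
        ⟨hLn hl, by rw [S.ρ_self n l (hLn hl)]; exact (S.u_pos n).le⟩
      refine le_trans (iInf₂_le (f := fun l' (_ : l' ∈ {l' ∈ S.Ln n | S.ρ n l l' ≤ S.u n}) =>
        (B.dens n (S.ψ n l l' θ) x : ℝ≥0∞)) l hmem) (le_trans hx ?_)
      gcongr
      exact hrate l hl)
  rw [mul_assoc, ENNReal.ofReal_mul (by norm_num), ENNReal.ofReal_ofNat]
  refine le_trans (measure_mono fun x hx => ?_) key
  have hx : S.evidenceScale a (c₃ + S.c₀ + 2) n * B.mass n (π n) x Set.univ <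
    B.dens n S.θ₀ x := hx
  have hDx : B.mass n (π n) x Set.univ < ENNReal.ofReal (Real.exp (-(c₃ * y))) *
      ENNReal.ofReal (Real.exp (-(S.c₀ * y))) * π n (Lt n) / 4 * B.dens n S.θ₀ x := by
    refine lt_of_mul_lt_mul_left' (a := S.evidenceScale a (c₃ + S.c₀ + 2) n)
      (hx.trans_le ?_)
    rw [← mul_assoc]
    refine le_mul_of_one_le_left zero_le ?_
    have hb4 : Real.exp (-y) ≤ b / 4 := by
      rw [← Real.log_le_log_iff (Real.exp_pos _) (by positivity), Real.log_exp,
        ← inv_div, Real.log_inv]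
      linarith
    calc (1 : ℝ≥0∞) = ENNReal.ofReal 1 := by simp
      _ ≤ ENNReal.ofReal (Real.exp ((c₃ + S.c₀ + 2) * y) * (Real.exp (-(c₃ * y)) *
            Real.exp (-(S.c₀ * y)) * (b * Real.exp (-(S.info n))) / 4)) := by
          refine ENNReal.ofReal_le_ofReal ?_
          calc (1 : ℝ) = Real.exp ((c₃ + S.c₀ + 2) * y) * (Real.exp (-(c₃ * y)) *
                Real.exp (-(S.c₀ * y)) * (Real.exp (-y) * Real.exp (-y))) := by
                simp only [← Real.exp_add]
                rw [eq_comm, Real.exp_eq_one_iff]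
                ring
            _ ≤ Real.exp ((c₃ + S.c₀ + 2) * y) * (Real.exp (-(c₃ * y)) *
                Real.exp (-(S.c₀ * y)) * (b / 4 * Real.exp (-(S.info n)))) := by gcongr
            _ = _ := by ring
      _ = S.evidenceScale a (c₃ + S.c₀ + 2) n * (ENNReal.ofReal (Real.exp (-(c₃ * y))) *
            ENNReal.ofReal (Real.exp (-(S.c₀ * y))) *
              ENNReal.ofReal (b * Real.exp (-(S.info n))) / 4) := by
          rw [ENNReal.ofReal_mul (by positivity), ENNReal.ofReal_div_of_pos (by norm_num),
            ENNReal.ofReal_mul (by positivity), ENNReal.ofReal_mul (by positivity),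
            ENNReal.ofReal_ofNat, evidenceScale, hy]
      _ ≤ _ := by gcongr
  simp only [BayesModel.mass, Measure.restrict_univ] at hDx
  exact hDx

theorem lintegral_q_mul_le_Q (n : ℕ) (l : L) (θ : Θ) (φ : X n → ℝ≥0∞) :
    ∫⁻ x, S.q n l θ x * (1 - φ x) ∂(B.μ n) ≤ S.Q n l θ :=
  lintegral_mono fun _ => mul_le_of_le_one_right zero_le tsub_le_self

/-- The hyper-parameters outside the oracle set do not contribute to the posterior. -/
theorem eventually_partialRisk_outside_le [BorelSpace Θ] {w a : ℕ → ℝ} {TA : ℕ → L → Set Θ}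
    (hTA : ∀ n l, MeasurableSet (TA n l)) (hw : Tendsto w atTop atTop) (hwM : w =o[atTop] S.M)
    (haw : ∀ s : ℝ, 0 < s → ∀ᶠ n in atTop, a n ≤ s * w n ^ 2)
    (hA1 : S.CondA1 TA w) (hA2 : S.CondA2 TA w) (hN : S.CoverOutside w)
    {cD : ℝ} (hcD : 0 < cD) :
    ∀ᶠ n in atTop, ∀ π : Measure L, IsProbabilityMeasure π → ∀ A : Set Θ, MeasurableSet A →
      B.partialRisk n S.θ₀ π (S.Ln n \ S.L0 n) A ≤
        B.law n S.θ₀ (B.evidenceFails n S.θ₀ π (S.evidenceScale a cD n)) +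
          ENNReal.ofReal (5 * Real.exp (-(S.info n))) := by
  obtain ⟨⟨η₁, hη₁, hQ⟩, hTc⟩ := hA1
  obtain ⟨ζ, c₁, hζ, -, hc₁, hc₁', hA2⟩ := hA2
  obtain ⟨η, hη, hN⟩ := hN
  have hc₀ : 0 < S.c₀ := zero_lt_one.trans_le S.one_le_c₀
  have hw2 : Tendsto (fun n => w n ^ 2) atTop atTop :=
    (tendsto_pow_atTop two_ne_zero).comp hw
  filter_upwards [hQ, hTc, hA2, hN, S.rate_spec, haw (c₁ / 8 / cD) (by positivity),
    hη.eventually_le_const (show 0 < c₁ / 8 by positivity),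
    hη₁.eventually_le_const (show 0 < S.c₀⁻¹ / 2 by positivity),
    hwM.bound (show 0 < (2 * S.c₀)⁻¹ by positivity),
    hw.eventually_gt_atTop 0, hw2.eventually_ge_atTop (4 / c₁),
    S.tendsto_info.eventually_ge_atTop 1, S.M_tendsto.eventually_gt_atTop 0]
    with n hQ hTc hA2 hN hspec haw hη hη₁ hwM hw0 hw4 hinfo hM0 π hπ A hA
  have hinfo0 : 0 < S.info n := by linarith
  have hr0 := S.rate0_pos_of_info_pos hinfo0
  obtain ⟨C, hCs, hcov, hCcard⟩ := exists_finset_of_coverNum_le hN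
  set z := w n ^ 2 * S.info n with hz
  have hz0 : 0 < z := by positivity
  have hzinfo : S.info n ≤ c₁ / 4 * z := by
    have h1 : 1 ≤ c₁ / 4 * w n ^ 2 := by
      rw [div_le_iff₀ hc₁] at hw4
      linarith
    calc S.info n ≤ c₁ / 4 * w n ^ 2 * S.info n := le_mul_of_one_le_left hinfo0.le h1
      _ = c₁ / 4 * z := by rw [hz]; ring
  have hMw : w n ^ 2 ≤ S.c₀⁻¹ / 2 * S.M n ^ 2 := by
    rw [Real.norm_of_nonneg hw0.le, Real.norm_of_nonneg hM0.le] at hwM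
    calc w n ^ 2 ≤ ((2 * S.c₀)⁻¹ * S.M n) ^ 2 := by gcongr
      _ = (2 * S.c₀)⁻¹ * (S.c₀⁻¹ / 2 * S.M n ^ 2) := by rw [mul_inv]; ring
      _ ≤ 1 * (S.c₀⁻¹ / 2 * S.M n ^ 2) := by
          gcongr
          refine inv_le_one_of_one_le₀ ?_
          linarith [S.one_le_c₀]
      _ = _ := one_mul _
  have htest : ∀ c ∈ C, ∃ φ : X n → ℝ≥0∞, Measurable φ ∧
      ∫⁻ x, φ x ∂(B.law n S.θ₀) ≤ ENNReal.ofReal (2 * Real.exp (-(c₁ * z / 2))) ∧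
      ∫⁻ θ in Set.univ, ∫⁻ x, S.q n c θ x * (1 - φ x) ∂(B.μ n) ∂(B.prior n c) ≤
        ENNReal.ofReal (3 * Real.exp (-(c₁ * z))) := by
    intro l hl
    have hlL := hCs hl
    have hrate : S.M n * S.rate0 n < S.rate n l := by
      by_contra hcon
      exact hlL.2 ⟨hlL.1, not_lt.mp hcon⟩
    have hrate0 : 0 < S.rate n l := lt_of_le_of_lt (by positivity) hrate
    obtain ⟨htests, c, hc, hsub, hent⟩ := hA2 l hlL
    rw [div_le_iff₀ hrate0] at hc
    set u := c * S.rate n l with hu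
    have hu0 : 0 < u := lt_of_lt_of_le (by positivity) hc
    have hzu : z ≤ n * u ^ 2 := by
      calc z = n * (w n * S.rate0 n) ^ 2 := by rw [hz, info]; ring
        _ ≤ n * u ^ 2 := by gcongr
    have hcz : c₁ * z ≤ c₁ * n * u ^ 2 := by
      rw [mul_assoc]; gcongr
    obtain ⟨φ, hφm, hφ1, hφ2⟩ := S.exists_global_test hζ hu0 hc₁ (by
      have : Real.log 2 ≤ 1 := by linarith [Real.log_two_lt_d9]
      linarith) htests hent
    refine ⟨φ, hφm, hφ1.trans (by gcongr), ?_⟩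
    set F := fun θ => ∫⁻ x, S.q n l θ x * (1 - φ x) ∂(B.μ n) with hF
    set U := {θ | ‖θ - S.θ₀‖ ≤ S.K * S.rate n l} with hU
    have hUm : MeasurableSet U := S.measurableSet_normBall _
    have hb1 : ∫⁻ θ in (TA n l)ᶜ, F θ ∂(B.prior n l) ≤
        ENNReal.ofReal (Real.exp (-(c₁ * z))) := by
      refine (lintegral_mono fun θ => S.lintegral_q_mul_le_Q n l θ φ).trans ((hTc l hlL).trans ?_)
      gcongr
      exact mul_le_of_le_one_left hz0.le hc₁'.le
    -- No test is needed here. Half of the prior exponent `S.c₀⁻¹ * (n * S.rate n l ^ 2)` absorbs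
    -- the perturbed mass; the other half exceeds `z`, because the rate is above `S.M n * S.rate0 n`
    -- and w = o(M).
    have hb2 : ∫⁻ θ in U ∩ TA n l, F θ ∂(B.prior n l) ≤
        ENNReal.ofReal (Real.exp (-(c₁ * z))) := by
      refine (setLIntegral_le_of_forall_le (hUm.inter (hTA n l)) fun θ hθ =>
        (S.lintegral_q_mul_le_Q n l θ φ).trans (hQ l hlL θ hθ)).trans ?_
      calc ENNReal.ofReal (Real.exp (η₁ n * (n * S.rate n l ^ 2))) *
              B.prior n l (U ∩ TA n l)
          ≤ ENNReal.ofReal (Real.exp (η₁ n * (n * S.rate n l ^ 2))) *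
              ENNReal.ofReal (Real.exp (-(S.c₀⁻¹ * (n * S.rate n l ^ 2)))) := by
            gcongr
            refine (measure_mono Set.inter_subset_left).trans ?_
            rw [← ENNReal.ofReal_toReal (measure_ne_top (B.prior n l) U)]
            exact ENNReal.ofReal_le_ofReal (hspec l hlL.1).2
        _ ≤ ENNReal.ofReal (Real.exp (-(c₁ * z))) := by
            rw [← ENNReal.ofReal_mul (Real.exp_pos _).le, ← Real.exp_add]
            gcongr
            have h1 : S.M n ^ 2 * S.info n ≤ n * S.rate n l ^ 2 := by
              calc S.M n ^ 2 * S.info n = n * (S.M n * S.rate0 n) ^ 2 := by rw [info]; ring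
                _ ≤ n * S.rate n l ^ 2 := by gcongr
            have h2 : z ≤ S.c₀⁻¹ / 2 * (n * S.rate n l ^ 2) :=
              calc z ≤ S.c₀⁻¹ / 2 * S.M n ^ 2 * S.info n := by rw [hz]; gcongr
                _ = S.c₀⁻¹ / 2 * (S.M n ^ 2 * S.info n) := by ring
                _ ≤ _ := by gcongr
            have h3 : η₁ n * (n * S.rate n l ^ 2) ≤ S.c₀⁻¹ / 2 * (n * S.rate n l ^ 2) := by
              gcongr
            have h4 : c₁ * z ≤ z := mul_le_of_le_one_left hz0.le hc₁'.le
            linarith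
    have hb3 : ∫⁻ θ in TA n l ∩ Uᶜ, F θ ∂(B.prior n l) ≤
        ENNReal.ofReal (Real.exp (-(c₁ * z))) := by
      refine (setLIntegral_le_of_forall_le ((hTA n l).inter hUm.compl) fun θ hθ =>
        (hφ2 θ hθ.1 ?_)).trans ((mul_le_of_le_one_right zero_le prob_le_one).trans (by gcongr))
      have hθU : ¬‖θ - S.θ₀‖ ≤ S.K * S.rate n l := hθ.2
      exact (hsub ⟨hθ.1, not_le.mp hθU⟩).2.le
    have hcover : (Set.univ : Set Θ) ⊆ (TA n l)ᶜ ∪ (U ∩ TA n l) ∪ (TA n l ∩ Uᶜ) := by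
      intro θ _
      by_cases h1 : θ ∈ TA n l <;> by_cases h2 : θ ∈ U <;> simp [h1, h2]
    calc ∫⁻ θ in Set.univ, F θ ∂(B.prior n l)
        ≤ ∫⁻ θ in (TA n l)ᶜ ∪ (U ∩ TA n l) ∪ (TA n l ∩ Uᶜ), F θ ∂(B.prior n l) :=
          lintegral_mono_set hcover
      _ ≤ ∫⁻ θ in (TA n l)ᶜ, F θ ∂(B.prior n l) + ∫⁻ θ in U ∩ TA n l, F θ ∂(B.prior n l) +
            ∫⁻ θ in TA n l ∩ Uᶜ, F θ ∂(B.prior n l) :=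
          (lintegral_union_le _ _ _).trans (by gcongr; exact lintegral_union_le _ _ _)
      _ ≤ ENNReal.ofReal (Real.exp (-(c₁ * z))) + ENNReal.ofReal (Real.exp (-(c₁ * z))) +
            ENNReal.ofReal (Real.exp (-(c₁ * z))) := by gcongr
      _ = ENNReal.ofReal (3 * Real.exp (-(c₁ * z))) := by
          rw [ENNReal.ofReal_mul (by norm_num), ENNReal.ofReal_ofNat]
          ring
  refine (S.partialRisk_le_of_cover π Set.sdiff_subset hCs hcov hA
    (V := fun _ => Set.univ) (fun _ _ _ _ _ _ _ => Set.mem_univ _)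
    (S.evidenceScale a cD n) htest).trans ?_
  rw [add_assoc]
  gcongr
  -- The net and the evidence cost `c₁ / 8 * z` each and the target `S.info n` at most `c₁ / 4 * z`,
  -- while the tests gain at least `c₁ / 2 * z`.
  have hs : η n * z ≤ c₁ / 8 * z := by gcongr
  have hr : cD * (a n * S.info n) ≤ c₁ / 8 * z := by
    calc cD * (a n * S.info n) ≤ cD * (c₁ / 8 / cD * w n ^ 2 * S.info n) := by gcongr
      _ = c₁ / 8 * z := by rw [hz]; field_simp
  exact card_mul_add_scale_mul_le hCcard rfl le_rfl le_rfl (by linarith) (by linarith)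

/-- The hyper-parameters in the oracle set only contribute to the posterior near the truth. -/
theorem exists_eventually_partialRisk_inside_le {a : ℕ → ℝ} {TC : ℝ → ℕ → L → Set Θ}
    (hTC : ∀ c n l, MeasurableSet (TC c n l)) (ha1 : ∀ n, 1 ≤ a n)
    (haM : ∀ s : ℝ, 0 < s → ∀ᶠ n in atTop, a n ≤ s * S.M n ^ 2)
    (hC : S.CondC TC a) (hN : S.CoverInside) {cD : ℝ} (hcD : 0 < cD) :
    ∃ R' : ℝ, 0 < R' ∧ ∀ᶠ n in atTop, ∀ π : Measure L, IsProbabilityMeasure π →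
      B.partialRisk n S.θ₀ π (S.L0 n) {θ | R' * S.M n * S.rate0 n ≤ S.d n θ S.θ₀} ≤
        B.law n S.θ₀ (B.evidenceFails n S.θ₀ π (S.evidenceScale a cD n)) +
          ENNReal.ofReal (5 * Real.exp (-(S.info n))) := by
  obtain ⟨D, hN⟩ := hN
  -- In the exponent c₂, `cD` pays for the evidence, `|D|` for the net, and 1 leaves the final
  -- exp(-I). As `cD` is already fixed, (C) is needed for arbitrarily large c₂.
  obtain ⟨hTc, c₁, ζ, R, C₀, hc₁, hc₁', hζ, -, hR, hC₀, hC⟩ :=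
    hC (cD + |D| + 1) (by positivity)
  have hD := abs_nonneg D
  refine ⟨R + C₀, by positivity, ?_⟩
  have hM2 : Tendsto (fun n => S.M n ^ 2) atTop atTop :=
    (tendsto_pow_atTop two_ne_zero).comp S.M_tendsto
  filter_upwards [hTc, hC, hN, haM (c₁ * R ^ 2 / 2 / cD) (by positivity),
    hM2.eventually_ge_atTop ((|D| + 1) / (c₁ * R ^ 2 / 2)),
    S.tendsto_info.eventually_ge_atTop 1, S.M_tendsto.eventually_gt_atTop 0]
    with n hTc hC hN haM hMbig hinfo hM0 π hπ
  have hinfo0 : 0 < S.info n := by linarith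
  have hr0 := S.rate0_pos_of_info_pos hinfo0
  obtain ⟨C, hCs, hcov, hCcard⟩ := exists_finset_of_coverNum_le hN
  set u := R * S.M n * S.rate0 n with hu
  have hu0 : 0 < u := by positivity
  set z := c₁ * n * u ^ 2 with hz
  have hz' : z = c₁ * R ^ 2 * S.M n ^ 2 * S.info n := by rw [hz, hu, info]; ring
  have hzinfo : (|D| + 1) * S.info n ≤ z / 2 := by
    rw [div_le_iff₀ (by positivity)] at hMbig
    calc (|D| + 1) * S.info n ≤ S.M n ^ 2 * (c₁ * R ^ 2 / 2) * S.info n := by gcongr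
      _ = z / 2 := by rw [hz']; ring
  have hDinfo : D * S.info n ≤ |D| * S.info n := by
    gcongr
    exact le_abs_self D
  have hDinfo0 : 0 ≤ |D| * S.info n := by positivity
  have hscale : cD * (a n * S.info n) ≤ z / 2 := by
    calc cD * (a n * S.info n) ≤ cD * (c₁ * R ^ 2 / 2 / cD * S.M n ^ 2 * S.info n) := by gcongr
      _ = z / 2 := by rw [hz']; field_simp
  have hainfo : S.info n ≤ a n * S.info n := le_mul_of_one_le_left hinfo0.le (ha1 n)
  have hDainfo : |D| * S.info n ≤ |D| * (a n * S.info n) := by gcongr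
  set g := -(cD * (a n * S.info n) + |D| * S.info n + S.info n) with hg
  set V : L → Set Θ := fun c => (TC (cD + |D| + 1) n c)ᶜ ∪
    (TC (cD + |D| + 1) n c ∩ {θ | u ≤ S.d n θ S.θ₀}) with hV
  have hdm := S.measurable_d n
  have htest : ∀ c ∈ C, ∃ φ : X n → ℝ≥0∞, Measurable φ ∧
      ∫⁻ x, φ x ∂(B.law n S.θ₀) ≤ ENNReal.ofReal (2 * Real.exp (-(z / 2))) ∧
      ∫⁻ θ in V c, ∫⁻ x, S.q n c θ x * (1 - φ x) ∂(B.μ n) ∂(B.prior n c) ≤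
        ENNReal.ofReal (3 * Real.exp g) := by
    intro l hl
    obtain ⟨htests, hent, -⟩ := hC l (hCs hl)
    obtain ⟨φ, hφm, hφ1, hφ2⟩ := S.exists_global_test hζ hu0 hc₁ (by
      have : Real.log 2 ≤ 1 := by linarith [Real.log_two_lt_d9]
      linarith) htests hent
    refine ⟨φ, hφm, hφ1, ?_⟩
    set F := fun θ => ∫⁻ x, S.q n l θ x * (1 - φ x) ∂(B.μ n) with hF
    have hb1 : ∫⁻ θ in (TC (cD + |D| + 1) n l)ᶜ, F θ ∂(B.prior n l) ≤
        ENNReal.ofReal (Real.exp g) := by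
      refine (lintegral_mono fun θ => S.lintegral_q_mul_le_Q n l θ φ).trans
        ((hTc l (hCs hl)).trans ?_)
      gcongr
      rw [hg]
      linarith
    have hb2 : ∫⁻ θ in TC (cD + |D| + 1) n l ∩ {θ | u ≤ S.d n θ S.θ₀}, F θ ∂(B.prior n l) ≤
        ENNReal.ofReal (Real.exp g) := by
      refine (setLIntegral_le_of_forall_le
        ((hTC _ n l).inter (measurableSet_le measurable_const hdm)) fun θ hθ =>
        (hφ2 θ hθ.1 hθ.2)).trans ((mul_le_of_le_one_right zero_le prob_le_one).trans ?_)
      gcongr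
      rw [hg]
      linarith
    calc ∫⁻ θ in V l, F θ ∂(B.prior n l)
        ≤ ENNReal.ofReal (Real.exp g) + ENNReal.ofReal (Real.exp g) :=
          (lintegral_union_le _ _ _).trans (add_le_add hb1 hb2)
      _ ≤ ENNReal.ofReal (3 * Real.exp g) := by
          rw [← ENNReal.ofReal_add (Real.exp_pos _).le (Real.exp_pos _).le]
          refine ENNReal.ofReal_le_ofReal ?_
          linarith [Real.exp_pos g]
  -- A point outside `V c` is in the sieve within `u` of θ₀; (C3) moves it by at most `C₀ * S.M n *
  -- S.rate0 n`, so its image stays inside the radius with constant `R + C₀`.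
  have hstab : ∀ c ∈ C, ∀ l ∈ S.L0 n, S.ρ n c l ≤ S.u n → ∀ θ,
      S.ψ n c l θ ∈ {θ | (R + C₀) * S.M n * S.rate0 n ≤ S.d n θ S.θ₀} → θ ∈ V c := by
    intro c hc l hl hcl θ hψ
    by_contra hθ
    simp only [hV, Set.mem_union, Set.mem_compl_iff, Set.mem_inter_iff, Set.mem_ofPred_eq,
      not_or, not_not, not_and, not_le] at hθ
    have hd := hθ.2 hθ.1
    have hs := S.d_semimetric n
    have h1 := (hC c (hCs hc)).2.2 θ ⟨(hs.symm _ _).trans_le hd.le, hθ.1⟩ l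
      (S.oracleSet_subset _ n hl) hcl
    have h2 := hs.triangle (S.ψ n c l θ) θ S.θ₀
    rw [hs.symm _ θ] at h2
    have hψ : (R + C₀) * S.M n * S.rate0 n ≤ S.d n (S.ψ n c l θ) S.θ₀ := hψ
    have h3 : (R + C₀) * S.M n * S.rate0 n = u + C₀ * S.M n * S.rate0 n := by rw [hu]; ring
    linarith
  refine (S.partialRisk_le_of_cover π (S.oracleSet_subset _ n) hCs hcov
    (measurableSet_le measurable_const hdm) hstab (S.evidenceScale a cD n) htest).trans ?_
  rw [add_assoc]
  gcongr
  exact card_mul_add_scale_mul_le hCcard rfl le_rfl le_rfl (by linarith) (by rw [hg]; linarith)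

/-- Reduction of posterior concentration to the contribution of the oracle set. -/
theorem tendsto_lintegral_hierPosterior [BorelSpace Θ] {w a : ℕ → ℝ} {TA : ℕ → L → Set Θ}
    (hTA : ∀ n l, MeasurableSet (TA n l)) (hw : Tendsto w atTop atTop) (hwM : w =o[atTop] S.M)
    (ha1 : ∀ n, 1 ≤ a n) (haw : ∀ s : ℝ, 0 < s → ∀ᶠ n in atTop, a n ≤ s * w n ^ 2)
    (hA1 : S.CondA1 TA w) (hA2 : S.CondA2 TA w) (hN : S.CoverOutside w)
    {cD C : ℝ} (hcD : 0 < cD) {π : ℕ → Measure L} (hπ : ∀ n, IsProbabilityMeasure (π n))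
    (hπLn : ∀ᶠ n in atTop, π n (S.Ln n)ᶜ ≤
      ENNReal.ofReal (Real.exp (-((cD + 1) * a n * S.info n))))
    (hE : ∀ᶠ n in atTop, B.law n S.θ₀
        (B.evidenceFails n S.θ₀ (π n) (S.evidenceScale a cD n)) ≤
      ENNReal.ofReal (C * Real.exp (-(S.info n))))
    {A : ℕ → Set Θ} (hA : ∀ n, MeasurableSet (A n))
    (hin : ∀ᶠ n in atTop, B.partialRisk n S.θ₀ (π n) (S.L0 n) (A n) ≤
      B.law n S.θ₀ (B.evidenceFails n S.θ₀ (π n) (S.evidenceScale a cD n)) +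
        ENNReal.ofReal (5 * Real.exp (-(S.info n)))) :
    Tendsto (fun n => ∫⁻ x, B.hierPosterior n (π n) x (A n) ∂(B.law n S.θ₀)) atTop (𝓝 0) := by
  have hexp : Tendsto (fun n => Real.exp (-(S.info n))) atTop (𝓝 0) :=
    Real.tendsto_exp_neg_atTop_nhds_zero.comp S.tendsto_info
  have hlim : ∀ c : ℝ, Tendsto (fun n => ENNReal.ofReal (c * Real.exp (-(S.info n)))) atTop
      (𝓝 0) := by
    intro c
    have h := (ENNReal.continuous_ofReal.tendsto (c * 0)).comp (hexp.const_mul c)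
    rwa [mul_zero, ENNReal.ofReal_zero] at h
  have hlim2 : Tendsto (fun n => ENNReal.ofReal (C * Real.exp (-(S.info n))) +
      ENNReal.ofReal (5 * Real.exp (-(S.info n)))) atTop (𝓝 0) := by
    simpa using (hlim C).add (hlim 5)
  have hlim6 := (hlim2.add hlim2).add hlim2
  rw [add_zero, add_zero] at hlim6
  refine tendsto_of_tendsto_of_tendsto_of_le_of_le' tendsto_const_nhds hlim6
    (Eventually.of_forall fun _ => zero_le) ?_
  filter_upwards [hπLn, hE, hin, S.eventually_partialRisk_outside_le hTA hw hwM haw hA1 hA2 hN hcD,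
    S.tendsto_info.eventually_ge_atTop 0] with n hπLn hE hin hout hinfo
  have hcover : (S.Ln n)ᶜ ∪ (S.Ln n \ S.L0 n) ∪ S.L0 n = Set.univ := by
    ext l
    by_cases h1 : l ∈ S.Ln n <;> by_cases h2 : l ∈ S.L0 n <;> simp [h1, h2]
  refine (B.lintegral_hierPosterior_le n S.θ₀ (π n) (hA n) _ _ _ hcover).trans ?_
  have hinfoa : S.info n ≤ a n * S.info n := le_mul_of_one_le_left hinfo (ha1 n)
  -- The exponent `cD + 1` of the hyper-prior tail cancels the evidence scale and leaves exp(-a I) ≤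
  -- exp(-I).
  have hfar : B.partialRisk n S.θ₀ (π n) (S.Ln n)ᶜ (A n) ≤
      ENNReal.ofReal (C * Real.exp (-(S.info n))) +
        ENNReal.ofReal (5 * Real.exp (-(S.info n))) := by
    refine (B.partialRisk_le_of_prior_le n S.θ₀ (π n) _ (hA n) (S.evidenceScale a cD n)
      (c := 1) fun l _ => prob_le_one).trans (add_le_add hE ?_)
    rw [one_mul]
    calc S.evidenceScale a cD n * π n (S.Ln n)ᶜ
        ≤ ENNReal.ofReal (Real.exp (cD * (a n * S.info n))) *
            ENNReal.ofReal (Real.exp (-((cD + 1) * a n * S.info n))) := by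
          rw [evidenceScale]; gcongr
      _ = ENNReal.ofReal (Real.exp (-(a n * S.info n))) := by
          rw [← ENNReal.ofReal_mul (Real.exp_pos _).le, ← Real.exp_add]
          congr 2
          ring
      _ ≤ ENNReal.ofReal (5 * Real.exp (-(S.info n))) := by
          refine ENNReal.ofReal_le_ofReal ?_
          have h1 : Real.exp (-(a n * S.info n)) ≤ Real.exp (-(S.info n)) := by gcongr
          linarith [Real.exp_pos (-(S.info n))]
  gcongr
  · exact (hout (π n) (hπ n) (A n) (hA n)).trans (by gcongr)
  · exact hin.trans (by gcongr)

end Setup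

/-! ### The theorem: fixing the constants -/

theorem theorem2p3
    {X : ℕ → Type*} [∀ n, MeasurableSpace (X n)]
    {Θ : Type*} [NormedAddCommGroup Θ] [NormedSpace ℝ Θ] [CompleteSpace Θ]
    [MeasurableSpace Θ] [BorelSpace Θ]
    {k : ℕ} {Λ : Set (EuclideanSpace ℝ (Fin k))}
    (B : BayesModel X Θ Λ) (S : Setup B)
    -- the sequences `w_n` and `w̃_n`, and the factor `max(1, w̃_n²)`
    (w wt a : ℕ → ℝ)
    (hw : Tendsto w atTop atTop) (hwM : w =o[atTop] S.M)
    (hwt : wt =o[atTop] fun n => min (S.M n) (w n))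
    (ha : ∀ n, a n = max 1 (wt n ^ 2))
    -- the sieves over `Λ_n \ Λ₀` and over `Λ₀`, and the sets `Λ̃₀`
    (TA : ℕ → Λ → Set Θ) (hTA : ∀ n l, MeasurableSet (TA n l))
    (TC : ℝ → ℕ → Λ → Set Θ) (hTC : ∀ c n l, MeasurableSet (TC c n l))
    (Lt : ℕ → Set Λ)
    (hA1 : S.CondA1 TA w) (hA2 : S.CondA2 TA w) (hB1 : S.CondB1 Lt)
    (hNout : S.CoverOutside w)
    (hC : S.CondC TC a) (hNin : S.CoverInside)
    (hH2 : S.CondH2 Lt) :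
    ∃ cbar : ℝ, 0 < cbar ∧
      ∀ π : ℕ → Measure Λ, (∀ n, IsProbabilityMeasure (π n)) →
        S.CondH1 Lt wt a cbar π →
        (∃ R : ℝ, 0 < R ∧
          Tendsto (fun n => ∫⁻ x, B.hierPosterior n (π n) x
              {θ | R * S.M n * S.rate0 n ≤ S.d n θ S.θ₀} ∂(B.law n S.θ₀))
            atTop (𝓝 0)) ∧
        ∀ (e : ℕ → Θ → Θ → ℝ) (δ : ℕ → ℝ), (∀ n, IsSemimetric (e n)) →
          (∀ n, Measurable fun θ => e n θ S.θ₀) → Tendsto δ atTop (𝓝 0) →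
          S.CondLower TC a e δ →
          Tendsto (fun n => ∫⁻ x, B.hierPosterior n (π n) x
              {θ | e n θ S.θ₀ ≤ δ n * S.rate0 n} ∂(B.law n S.θ₀))
            atTop (𝓝 0) := by
  have ha1 : ∀ n, 1 ≤ a n := fun n => by rw [ha]; exact le_max_left _ _
  -- This says a = o(v²), used for v = w and v = M: the 1 in the maximum is absorbed by v² → ∞, and
  -- the other term by the assumption on w̃.
  have hbound : ∀ v : ℕ → ℝ, Tendsto v atTop atTop → (∀ n, min (S.M n) (w n) ≤ v n) →
      ∀ s : ℝ, 0 < s → ∀ᶠ n in atTop, a n ≤ s * v n ^ 2 := by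
    intro v hv hmin s hs
    filter_upwards [hwt.bound (Real.sqrt_pos.mpr hs), S.M_tendsto.eventually_ge_atTop 0,
      hw.eventually_ge_atTop 0,
      ((tendsto_pow_atTop two_ne_zero).comp hv).eventually_ge_atTop s⁻¹] with n hn hM0 hw0 hv2
    have hmin0 : 0 ≤ min (S.M n) (w n) := le_min hM0 hw0
    rw [ha]
    refine max_le ?_ ?_
    · exact (inv_le_iff_one_le_mul₀' hs).mp hv2
    · rw [Real.norm_of_nonneg hmin0, Real.norm_eq_abs] at hn
      calc wt n ^ 2 = |wt n| ^ 2 := (sq_abs _).symm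
        _ ≤ (Real.sqrt s * v n) ^ 2 := by
            gcongr
            exact hn.trans (by gcongr; exact hmin n)
        _ = s * v n ^ 2 := by rw [mul_pow, Real.sq_sqrt hs.le]
  have haw := hbound w hw fun n => min_le_right _ _
  have haM := hbound S.M S.M_tendsto fun n => min_le_left _ _
  obtain ⟨cD, C, hcD, hE⟩ := S.exists_law_evidenceFails_le ha hH2
  refine ⟨cD + 1, by positivity, fun π hπ ⟨hsub, hLt, hπLn⟩ => ?_⟩
  have hE := hE π hπ hsub hLt
  constructor
  · obtain ⟨R, hR, hin⟩ := S.exists_eventually_partialRisk_inside_le hTC ha1 haM hC hNin hcD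
    refine ⟨R, hR, S.tendsto_lintegral_hierPosterior hTA hw hwM ha1 haw hA1 hA2 hNout hcD hπ hπLn
      hE (fun n => measurableSet_le measurable_const (S.measurable_d n)) ?_⟩
    filter_upwards [hin] with n hin using hin (π n) (hπ n)
  · intro e δ he hem _ hlow
    have hA : ∀ n, MeasurableSet {θ | e n θ S.θ₀ ≤ δ n * S.rate0 n} :=
      fun n => measurableSet_le (hem n) measurable_const
    refine S.tendsto_lintegral_hierPosterior hTA hw hwM ha1 haw hA1 hA2 hNout hcD hπ hπLn hE hA ?_
    filter_upwards [hlow.2 (cD + 1) (by positivity), S.tendsto_info.eventually_ge_atTop 0]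
      with n hlow hinfo
    -- `δ n` may be negative, but a point of the set has 0 ≤ e ≤ δε₀, so doubling the radius still
    -- enlarges the set.
    have hsmall : ∀ l ∈ S.L0 n, B.prior n l {θ | e n θ S.θ₀ ≤ δ n * S.rate0 n} ≤
        ENNReal.ofReal (Real.exp (-((cD + 1) * a n * S.info n))) := by
      refine fun l hl => (measure_mono fun θ hθ => ?_).trans (hlow l hl)
      have hθ : e n θ S.θ₀ ≤ δ n * S.rate0 n := hθ
      have h0 := (he n).nonneg θ S.θ₀
      calc e n θ S.θ₀ ≤ 2 * (δ n * S.rate0 n) := by linarith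
        _ = 2 * δ n * S.rate0 n := by ring
    refine (B.partialRisk_le_of_prior_le n S.θ₀ (π n) _ (hA n) (S.evidenceScale a cD n)
      hsmall).trans (add_le_add le_rfl ?_)
    have hinfoa : S.info n ≤ a n * S.info n := le_mul_of_one_le_left hinfo (ha1 n)
    calc S.evidenceScale a cD n *
          (ENNReal.ofReal (Real.exp (-((cD + 1) * a n * S.info n))) * π n (S.L0 n))
        ≤ ENNReal.ofReal (Real.exp (cD * (a n * S.info n))) *
            ENNReal.ofReal (Real.exp (-((cD + 1) * a n * S.info n))) := by
          rw [Setup.evidenceScale]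
          gcongr
          exact mul_le_of_le_one_right zero_le prob_le_one
      _ = ENNReal.ofReal (Real.exp (-(a n * S.info n))) := by
          rw [← ENNReal.ofReal_mul (Real.exp_pos _).le, ← Real.exp_add]
          congr 2
          ring
      _ ≤ ENNReal.ofReal (5 * Real.exp (-(S.info n))) := by
          refine ENNReal.ofReal_le_ofReal ?_
          have h1 : Real.exp (-(a n * S.info n)) ≤ Real.exp (-(S.info n)) := by gcongr
          linarith [Real.exp_pos (-(S.info n))]
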